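/- **Conventions.** For a $C^*$-algebra $A$ let $A_\infty=\ell^\infty(\mathbb N,A)/c_0(\mathbb N,A)$, let $A\subset A_\infty$ be embedded by constant sequences, and let $T(A)$ be the set of tracial states of a unital $C^*$-algebra $A$. Projections $p,q$ are Murray–von Neumann equivalent, $p\sim q$, if $p=v^*v$ and $q=vv^*$ for some $v$. The zero algebra counts as a unital $C^*$-algebra. **Split maps.** Let $A,B$ be unital $C^*$-algebras. A (not necessarily unital) $*$-homomorphism $\phi:A\to B$ is *tracially sequentially split* if for every nonzero positive $z\in A_\infty$ there are a $*$-homomorphism $\psi:B\to A_\infty$ and a nonzero projection $g\in A_\infty\cap A'$ such that $\psi(\phi(a))=ag$ for all $a\in A$ and $1_{A_\infty}-g$ is Murray–von Neumann equivalent to a projection in $\overline{zA_\infty z}$. It is *tracially sequentially split in the trace form* if for every $\delta>0$ there are a $*$-homomorphism $\psi:B\to A_\infty$ and a projection $g\in A_\infty\cap A'$ such that $\psi(\phi(a))=ag$ for all $a\in A$ and $\tau(1-g)<\delta$ for all $\tau\in T(A_\infty)$. **The class.** Let $\mathcal C$ be an isomorphism-invariant class of unital separable $C^*$-algebras, each weakly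 semiprojective (every $*$-homomorphism $D\to\prod_n E_n/\bigoplus_n E_n$, with $E_n$ any $C^*$-algebras, lifts to a $*$-homomorphism $D\to\prod_n E_n$; in particular, semiprojective algebras are allowed), such that 1. every quotient $Q$ of an algebra in $\mathcal C$ is locally approximated by algebras in $\mathcal C$: for every finite $F\subset Q$ and $\varepsilon>0$ there is a $C^*$-subalgebra $C\subset Q$ in $\mathcal C$ with $1_C=1_Q$ and $\operatorname{dist}(x,C)\le\varepsilon$ for all $x\in F$; 2. if $D\in\mathcal C$ then $M_n(D)\in\mathcal C$ for all $n\ge1$; 3. if $D\in\mathcal C$ then every unital hereditary $C^*$-subalgebra of $D$ is in $\mathcal C$. **Tracial approximation.** A unital $C^*$-algebra $A$ belongs to $\mathrm{TA}\,\mathcal C$ if for every finite $F\subset A$, every $\varepsilon>0$ and every nonzero positive $a\in A$ there are a projection $p\in A$ and a $C^*$-subalgebra $C\subset A$ in $\mathcal C$ with $1_C=p$ such that for all $x\in F$: (i) $\|px-xp\|\le\varepsilon$; (ii) $\operatorname{dist}(pxp,C)\le\varepsilon$; (iii) $1-p$ is Murray–von Neumann equivalent to a projection in $\overline{aAa}$.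 It belongs to $\mathrm{TA}\,\mathcal C$ *in the trace-small-defect form* if for every finite $F\subset A$ and $\varepsilon>0$ there are such $p$ and $C$ with (i), (ii) and (iii)$'$ $\tau(1-p)\le\varepsilon$ for all $\tau\in T(A)$. (The form (iii)$'$ is the one used for classes with the strict comparison property; no comparison hypothesis is needed below.) **Theorem.** Let $A,B$ be unital $C^*$-algebras, $\phi:A\to B$ a $*$-homomorphism, and $\mathcal C$ a class as above. (a) If $\phi$ is tracially sequentially split, or tracially sequentially split in the trace form, and $B$ belongs to $\mathrm{TA}\,\mathcal C$ in the trace-small-defect form, then $A$ belongs to $\mathrm{TA}\,\mathcal C$ in the trace-small-defect form. (b) If $\phi$ is tracially sequentially split and $B$ belongs to $\mathrm{TA}\,\mathcal C$, then $A$ belongs to $\mathrm{TA}\,\mathcal C$. -/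

import Mathlib

open scoped ENNReal Topology
open Filter

universe u

/-! ### Sequence algebras -/

section Corona

variable (B : ℕ → Type u) [∀ n, NonUnitalCStarAlgebra (B n)]

/-- The direct sum `⨁ Bₙ` (sequences with `‖fₙ‖ → 0`) inside the product `∏ Bₙ`
(bounded sequences, `lp B ∞`). -/
def c0Seq : Submodule ℂ (lp B ∞) where
  carrier := {f | Tendsto (fun n => ‖f n‖) atTop (𝓝 0)}
  zero_mem' := by simp
  add_mem' := by
    intro f g hf hg
    refine squeeze_zero (fun n => norm_nonneg _) (fun n => ?_) (by simpa using hf.add hg)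
    exact norm_add_le (f n) (g n)
  smul_mem' := by
    intro c f hf
    refine squeeze_zero (fun n => norm_nonneg _) (fun n => ?_) (by simpa using hf.const_mul ‖c‖)
    exact (norm_smul c (f n)).le

variable {B}

theorem mem_c0Seq {f : lp B ∞} : f ∈ c0Seq B ↔ Tendsto (fun n => ‖f n‖) atTop (𝓝 0) := Iff.rfl

theorem c0Seq_mul_left (f : lp B ∞) {g : lp B ∞} (hg : g ∈ c0Seq B) : f * g ∈ c0Seq B := by
  refine squeeze_zero (fun n => norm_nonneg _) (fun n => ?_) (by simpa using hg.const_mul ‖f‖)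
  exact (norm_mul_le (f n) (g n)).trans
    (mul_le_mul_of_nonneg_right (lp.norm_apply_le_norm ENNReal.top_ne_zero f n) (norm_nonneg _))

theorem c0Seq_mul_right {f : lp B ∞} (hf : f ∈ c0Seq B) (g : lp B ∞) : f * g ∈ c0Seq B := by
  refine squeeze_zero (fun n => norm_nonneg _) (fun n => ?_) (by simpa using hf.mul_const ‖g‖)
  exact (norm_mul_le (f n) (g n)).trans
    (mul_le_mul_of_nonneg_left (lp.norm_apply_le_norm ENNReal.top_ne_zero g n) (norm_nonneg _))

theorem c0Seq_star {f : lp B ∞} (hf : f ∈ c0Seq B) : star f ∈ c0Seq B := by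
  have h : (fun n => ‖(star f) n‖) = fun n => ‖f n‖ := by
    funext n
    exact norm_star (f n)
  rw [mem_c0Seq, h]
  exact hf

instance c0Seq_isClosed : IsClosed (c0Seq B : Set (lp B ∞)) := by
  rw [← isSeqClosed_iff_isClosed]
  intro F f hF hf
  change Tendsto (fun n => ‖f n‖) atTop (𝓝 0)
  rw [Metric.tendsto_atTop]
  intro ε hε
  obtain ⟨k, hk⟩ := (Metric.tendsto_atTop.1 hf (ε / 2) (half_pos hε))
  obtain ⟨N, hN⟩ := (Metric.tendsto_atTop.1 (hF k) (ε / 2) (half_pos hε))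
  refine ⟨N, fun n hn => ?_⟩
  have h1 : ‖F k n‖ < ε / 2 := by simpa using hN n hn
  have h2 : ‖F k - f‖ < ε / 2 := by simpa [dist_eq_norm] using hk k le_rfl
  have h3 : ‖F k n - f n‖ ≤ ‖F k - f‖ := lp.norm_apply_le_norm ENNReal.top_ne_zero (F k - f) n
  have h4 : ‖f n‖ ≤ ‖F k n‖ + ‖F k n - f n‖ := by
    have := norm_sub_le (F k n) (F k n - f n)
    simpa using this
  simp only [dist_zero_right, norm_norm]
  linarith

variable (B)

/-- The quotient C⋆-algebra `∏ Bₙ / ⨁ Bₙ`. -/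
def SeqCorona : Type u := lp B ∞ ⧸ c0Seq B

namespace SeqCorona

noncomputable instance : NormedAddCommGroup (SeqCorona B) :=
  inferInstanceAs (NormedAddCommGroup (lp B ∞ ⧸ c0Seq B))

noncomputable instance : NormedSpace ℂ (SeqCorona B) :=
  inferInstanceAs (NormedSpace ℂ (lp B ∞ ⧸ c0Seq B))

instance : CompleteSpace (SeqCorona B) :=
  inferInstanceAs (CompleteSpace (lp B ∞ ⧸ c0Seq B))

variable {B}

/-- The class of a bounded sequence, as a linear map. -/
noncomputable def mkₗ : lp B ∞ →ₗ[ℂ] SeqCorona B := (c0Seq B).mkQ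

theorem mkₗ_surjective : Function.Surjective (mkₗ (B := B)) := (c0Seq B).mkQ_surjective

theorem mkₗ_eq_iff {f g : lp B ∞} : mkₗ f = mkₗ g ↔ f - g ∈ c0Seq B :=
  Submodule.Quotient.eq (c0Seq B)

theorem norm_mkₗ_le (f : lp B ∞) : ‖mkₗ f‖ ≤ ‖f‖ := Submodule.Quotient.norm_mk_le (c0Seq B) f

theorem exists_norm_lt (x : SeqCorona B) {r : ℝ} (hr : ‖x‖ < r) : ∃ f, mkₗ f = x ∧ ‖f‖ < r := by
  obtain ⟨m, hm, hlt⟩ := Submodule.Quotient.norm_mk_lt (S := c0Seq B) x (sub_pos.2 hr)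
  refine ⟨m, hm, hlt.trans_le ?_⟩
  change ‖x‖ + (r - ‖x‖) ≤ r
  linarith

noncomputable instance : Mul (SeqCorona B) where
  mul x y := Quotient.map₂ (fun f g : lp B ∞ => f * g) (by
    intro f f' hf g g' hg
    have hf' : f - f' ∈ c0Seq B := (Submodule.quotientRel_def _).1 hf
    have hg' : g - g' ∈ c0Seq B := (Submodule.quotientRel_def _).1 hg
    refine (Submodule.quotientRel_def _).2 ?_
    have h : f * g - f' * g' = (f - f') * g + f' * (g - g') := by
      rw [sub_mul, mul_sub]; abel
    rw [h]
    exact add_mem (c0Seq_mul_right hf' g) (c0Seq_mul_left f' hg')) x y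

noncomputable instance : Star (SeqCorona B) where
  star x := Quotient.map (fun f : lp B ∞ => star f) (by
    intro f f' hf
    have hf' : f - f' ∈ c0Seq B := (Submodule.quotientRel_def _).1 hf
    refine (Submodule.quotientRel_def _).2 ?_
    rw [← star_sub]
    exact c0Seq_star hf') x

theorem mkₗ_mul (f g : lp B ∞) : mkₗ (f * g) = mkₗ f * mkₗ g := rfl

theorem mkₗ_star (f : lp B ∞) : mkₗ (star f) = star (mkₗ f) := rfl

/-- The norm of a class is at most every eventual bound of a representing sequence. -/
theorem norm_mkₗ_le_of_eventually (f : lp B ∞) {r : ℝ} (hr : 0 ≤ r)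
    (h : ∀ᶠ n in atTop, ‖f n‖ ≤ r) : ‖mkₗ f‖ ≤ r := by
  classical
  obtain ⟨N, hN⟩ := eventually_atTop.1 h
  let g : lp B ∞ := ⟨fun n => if N ≤ n then f n else 0, by
    refine memℓp_infty ⟨r, ?_⟩
    rintro _ ⟨n, rfl⟩
    by_cases hn : N ≤ n
    · simpa [hn] using hN n hn
    · simpa [hn] using hr⟩
  have hg : ∀ n, g n = if N ≤ n then f n else 0 := fun n => rfl
  have hfg : mkₗ f = mkₗ g := by
    rw [mkₗ_eq_iff, mem_c0Seq]
    refine tendsto_const_nhds.congr' ?_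
    filter_upwards [eventually_ge_atTop N] with n hn
    have : (f - g) n = f n - g n := rfl
    simp [this, hg, hn]
  rw [hfg]
  refine (norm_mkₗ_le g).trans (lp.norm_le_of_forall_le hr fun n => ?_)
  by_cases hn : N ≤ n
  · simpa [hg, hn] using hN n hn
  · simpa [hg, hn] using hr

theorem eventually_norm_lt (f : lp B ∞) {r : ℝ} (h : ‖mkₗ f‖ < r) : ∀ᶠ n in atTop, ‖f n‖ < r := by
  obtain ⟨g, hg, hlt⟩ := exists_norm_lt _ h
  have hd : Tendsto (fun n => ‖(f - g) n‖) atTop (𝓝 0) := mkₗ_eq_iff.1 hg.symm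
  filter_upwards [hd.eventually (gt_mem_nhds (sub_pos.2 hlt))] with n hn
  have h1 : (f - g) n = f n - g n := rfl
  have h2 : ‖g n‖ ≤ ‖g‖ := lp.norm_apply_le_norm ENNReal.top_ne_zero g n
  have h3 : ‖f n‖ ≤ ‖f n - g n‖ + ‖g n‖ := by simpa using norm_add_le (f n - g n) (g n)
  rw [h1] at hn
  linarith

/-- The quotient norm is `limsup ‖fₙ‖`. -/
theorem norm_mkₗ (f : lp B ∞) : ‖mkₗ f‖ = limsup (fun n => ‖f n‖) atTop := by
  have hb : IsBoundedUnder (· ≤ ·) atTop fun n => ‖f n‖ :=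
    isBoundedUnder_of ⟨‖f‖, fun n => lp.norm_apply_le_norm ENNReal.top_ne_zero f n⟩
  have hc : IsCoboundedUnder (· ≤ ·) atTop fun n => ‖f n‖ :=
    (isBoundedUnder_of ⟨0, fun n => norm_nonneg (f n)⟩ :
      IsBoundedUnder (· ≥ ·) atTop fun n => ‖f n‖).isCoboundedUnder_le
  apply le_antisymm
  · refine le_of_forall_gt_imp_ge_of_dense fun r hr => ?_
    have h := eventually_lt_of_limsup_lt hr hb
    have h0 : 0 ≤ r := by
      obtain ⟨n, hn⟩ := h.exists
      exact (norm_nonneg _).trans hn.le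
    exact norm_mkₗ_le_of_eventually f h0 (h.mono fun n hn => hn.le)
  · refine le_of_forall_gt_imp_ge_of_dense fun r hr => ?_
    exact limsup_le_of_le hc ((eventually_norm_lt f hr).mono fun n hn => hn.le)

noncomputable instance : NonUnitalCStarAlgebra (SeqCorona B) where
  __ := (inferInstance : NormedAddCommGroup (SeqCorona B))
  __ := (inferInstance : NormedSpace ℂ (SeqCorona B))
  complete := CompleteSpace.complete
  left_distrib x y z := by
    obtain ⟨f, rfl⟩ := mkₗ_surjective x
    obtain ⟨g, rfl⟩ := mkₗ_surjective y
    obtain ⟨h, rfl⟩ := mkₗ_surjective z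
    simp only [← mkₗ_mul, ← map_add, mul_add]
  right_distrib x y z := by
    obtain ⟨f, rfl⟩ := mkₗ_surjective x
    obtain ⟨g, rfl⟩ := mkₗ_surjective y
    obtain ⟨h, rfl⟩ := mkₗ_surjective z
    simp only [← mkₗ_mul, ← map_add, add_mul]
  zero_mul x := by
    obtain ⟨f, rfl⟩ := mkₗ_surjective x
    rw [← map_zero mkₗ, ← mkₗ_mul, zero_mul]
  mul_zero x := by
    obtain ⟨f, rfl⟩ := mkₗ_surjective x
    rw [← map_zero mkₗ, ← mkₗ_mul, mul_zero]
  mul_assoc x y z := by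
    obtain ⟨f, rfl⟩ := mkₗ_surjective x
    obtain ⟨g, rfl⟩ := mkₗ_surjective y
    obtain ⟨h, rfl⟩ := mkₗ_surjective z
    simp only [← mkₗ_mul, mul_assoc]
  norm_mul_le x y := by
    have key : ∀ s, ‖x‖ < s → ∀ t, ‖y‖ < t → ‖x * y‖ ≤ s * t := by
      intro s hs t ht
      obtain ⟨f, rfl, hf⟩ := exists_norm_lt x hs
      obtain ⟨g, rfl, hg⟩ := exists_norm_lt y ht
      rw [← mkₗ_mul]
      exact (norm_mkₗ_le _).trans ((norm_mul_le f g).trans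
        (mul_le_mul hf.le hg.le (norm_nonneg _) ((norm_nonneg _).trans hf.le)))
    have hc : Tendsto (fun ε : ℝ => (‖x‖ + ε) * (‖y‖ + ε)) (𝓝[>] 0) (𝓝 (‖x‖ * ‖y‖)) := by
      have : Continuous fun ε : ℝ => (‖x‖ + ε) * (‖y‖ + ε) := by fun_prop
      simpa using (this.tendsto 0).mono_left nhdsWithin_le_nhds
    refine ge_of_tendsto hc ?_
    filter_upwards [self_mem_nhdsWithin] with ε hε
    have hε' : (0 : ℝ) < ε := hε
    exact key _ (by linarith) _ (by linarith)
  star_involutive x := by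
    obtain ⟨f, rfl⟩ := mkₗ_surjective x
    simp only [← mkₗ_star, star_star]
  star_mul x y := by
    obtain ⟨f, rfl⟩ := mkₗ_surjective x
    obtain ⟨g, rfl⟩ := mkₗ_surjective y
    simp only [← mkₗ_star, ← mkₗ_mul, star_mul]
  star_add x y := by
    obtain ⟨f, rfl⟩ := mkₗ_surjective x
    obtain ⟨g, rfl⟩ := mkₗ_surjective y
    simp only [← mkₗ_star, ← map_add, star_add]
  norm_mul_self_le x := by
    obtain ⟨f, rfl⟩ := mkₗ_surjective x
    refine le_of_forall_gt_imp_ge_of_dense fun r hr => ?_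
    rw [← mkₗ_star, ← mkₗ_mul] at hr
    have hr0 : 0 ≤ r := (norm_nonneg _).trans hr.le
    have h : ‖mkₗ f‖ ≤ √r := by
      refine norm_mkₗ_le_of_eventually f (Real.sqrt_nonneg r) ?_
      filter_upwards [eventually_norm_lt _ hr] with n hn
      have h1 : (star f * f) n = star (f n) * f n := rfl
      rw [h1, CStarRing.norm_star_mul_self] at hn
      exact Real.le_sqrt_of_sq_le (by rw [sq]; exact hn.le)
    calc ‖mkₗ f‖ * ‖mkₗ f‖ ≤ √r * √r := mul_le_mul h h (norm_nonneg _) (Real.sqrt_nonneg r)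
      _ = r := Real.mul_self_sqrt hr0
  smul_assoc c x y := by
    obtain ⟨f, rfl⟩ := mkₗ_surjective x
    obtain ⟨g, rfl⟩ := mkₗ_surjective y
    simp only [smul_eq_mul, ← mkₗ_mul, ← map_smul, smul_mul_assoc]
  smul_comm c x y := by
    obtain ⟨f, rfl⟩ := mkₗ_surjective x
    obtain ⟨g, rfl⟩ := mkₗ_surjective y
    simp only [smul_eq_mul, ← mkₗ_mul, ← map_smul, mul_smul_comm]
  star_smul c x := by
    obtain ⟨f, rfl⟩ := mkₗ_surjective x
    simp only [← mkₗ_star, ← map_smul, star_smul]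

variable (B) in
/-- The quotient `*`-homomorphism `∏ Bₙ → ∏ Bₙ / ⨁ Bₙ`. -/
noncomputable def mk : lp B ∞ →⋆ₙₐ[ℂ] SeqCorona B where
  toFun := mkₗ
  map_smul' c f := map_smul mkₗ c f
  map_zero' := map_zero mkₗ
  map_add' := map_add mkₗ
  map_mul' := mkₗ_mul
  map_star' := mkₗ_star

end SeqCorona

end Corona

/-- `A_∞ = ℓ^∞(ℕ, A) / c₀(ℕ, A)`. -/
abbrev SeqAlg (A : Type u) [NonUnitalCStarAlgebra A] : Type u := SeqCorona fun _ : ℕ => A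

/-- The embedding of `A` into `A_∞` by constant sequences. When `A` is unital, `constSeq A 1` is
the unit of `A_∞`. -/
noncomputable def constSeq (A : Type u) [NonUnitalCStarAlgebra A] : A →⋆ₙₐ[ℂ] SeqAlg A :=
  (SeqCorona.mk fun _ : ℕ => A).comp
    { toFun := fun a => ⟨fun _ => a, memℓp_infty ⟨‖a‖, by rintro _ ⟨n, rfl⟩; exact le_rfl⟩⟩
      map_smul' := fun _ _ => rfl
      map_zero' := rfl
      map_add' := fun _ _ => rfl
      map_mul' := fun _ _ => rfl
      map_star' := fun _ => rfl }

/-! ### Positivity, projections, traces -/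

section Basic

variable {A : Type u} [NonUnitalCStarAlgebra A]

/-- Positive elements of a C⋆-algebra. -/
def IsPos (a : A) : Prop := ∃ y : A, a = star y * y

/-- The hereditary C⋆-subalgebra `closure (a A a)` generated by a positive element `a`. -/
def herSet (a : A) : Set A := closure (Set.range fun x : A => a * x * a)

/-- Murray–von Neumann equivalence. -/
def MvNEquiv (p q : A) : Prop := ∃ v : A, star v * v = p ∧ v * star v = q

/-- `p` is Murray–von Neumann equivalent to a projection in `closure (a A a)`. -/
def MvNBelow (p a : A) : Prop := ∃ q ∈ herSet a, IsStarProjection q ∧ MvNEquiv p q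

open scoped ComplexOrder in
/-- `τ` is a tracial state on the C⋆-algebra `A` with unit `e`. -/
structure IsTracialState (e : A) (τ : A →ₗ[ℂ] ℂ) : Prop where
  nonneg : ∀ x, 0 ≤ τ (star x * x)
  map_unit : τ e = 1
  tracial : ∀ x y, τ (x * y) = τ (y * x)

/-- `e` is a unit of the algebra. -/
def IsUnitOf (e : A) : Prop := ∀ x : A, e * x = x ∧ x * e = x

end Basic

/-! ### Classes of C⋆-algebras -/

/-- A class of C⋆-algebras. -/
abbrev CStarClass : Type (u + 1) := (D : Type u) → [NonUnitalCStarAlgebra D] → Prop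

/-- The closed `*`-subalgebra `C` of `A`, as a C⋆-algebra, belongs to the class `𝒞`, and `p` is the
unit of `C`. -/
structure IsSubIn (𝒞 : CStarClass.{u}) {A : Type u} [NonUnitalCStarAlgebra A]
    (C : NonUnitalStarSubalgebra ℂ A) (p : A) : Prop where
  isClosed : IsClosed (C : Set A)
  mem_class : 𝒞 C
  unit_mem : p ∈ C
  unit_mul : ∀ c ∈ C, p * c = c
  mul_unit : ∀ c ∈ C, c * p = c

/-- Every `*`-homomorphism `D → ∏ Eₙ / ⨁ Eₙ` lifts to a `*`-homomorphism `D → ∏ Eₙ`. -/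
def IsWeaklySemiprojective (D : Type u) [NonUnitalCStarAlgebra D] : Prop :=
  ∀ (E : ℕ → Type u) [∀ n, NonUnitalCStarAlgebra (E n)] (f : D →⋆ₙₐ[ℂ] SeqCorona E),
    ∃ k : D →⋆ₙₐ[ℂ] lp E ∞, ∀ d, SeqCorona.mk E (k d) = f d

/-- The unital C⋆-algebra `Q` is locally approximated by unital C⋆-subalgebras in `𝒞`
(containing the unit of `Q`). -/
def LocallyApprox (𝒞 : CStarClass.{u}) (Q : Type u) [NonUnitalCStarAlgebra Q] : Prop :=
  ∀ (F : Finset Q) (ε : ℝ), 0 < ε → ∃ (e : Q) (C : NonUnitalStarSubalgebra ℂ Q),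
    IsUnitOf e ∧ IsSubIn 𝒞 C e ∧ ∀ x ∈ F, Metric.infDist x (C : Set Q) ≤ ε

/-- `H` is a hereditary C⋆-subalgebra of `D`. -/
structure IsHereditarySub {D : Type u} [NonUnitalCStarAlgebra D]
    (H : NonUnitalStarSubalgebra ℂ D) : Prop where
  isClosed : IsClosed (H : Set D)
  hereditary : ∀ x y : D, IsPos x → IsPos (y - x) → y ∈ H → x ∈ H

/-- Isomorphism-invariant classes of unital separable weakly semiprojective C⋆-algebras whose
quotients are locally approximated by members of the class, closed under matrix amplifications and
under (unital) hereditary subalgebras. Quotients are given as surjective `*`-homomorphisms. -/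
structure IsApproxClass (𝒞 : CStarClass.{u}) : Prop where
  iso : ∀ (D E : Type u) [NonUnitalCStarAlgebra D] [NonUnitalCStarAlgebra E],
    𝒞 D → Nonempty (D ≃⋆ₐ[ℂ] E) → 𝒞 E
  unital : ∀ (D : Type u) [NonUnitalCStarAlgebra D], 𝒞 D → ∃ e : D, IsUnitOf e
  separable : ∀ (D : Type u) [NonUnitalCStarAlgebra D], 𝒞 D → TopologicalSpace.SeparableSpace D
  weaklySemiprojective : ∀ (D : Type u) [NonUnitalCStarAlgebra D], 𝒞 D → IsWeaklySemiprojective D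
  quotient : ∀ (D Q : Type u) [NonUnitalCStarAlgebra D] [NonUnitalCStarAlgebra Q], 𝒞 D →
    ∀ f : D →⋆ₙₐ[ℂ] Q, Function.Surjective f → LocallyApprox 𝒞 Q
  matrix : ∀ (D : Type u) [NonUnitalCStarAlgebra D] [PartialOrder D] [StarOrderedRing D] (n : ℕ),
    0 < n → 𝒞 D → 𝒞 (CStarMatrix (Fin n) (Fin n) D)
  hereditary : ∀ (D : Type u) [NonUnitalCStarAlgebra D], 𝒞 D →
    ∀ H : NonUnitalStarSubalgebra ℂ D, ∀ hH : IsHereditarySub H,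
      (∃ e : H, ∀ x : H, e * x = x ∧ x * e = x) →
      haveI : IsClosed (H : Set D) := hH.isClosed
      𝒞 H

/-! ### Tracial approximation -/

section TA

variable (𝒞 : CStarClass.{u}) (A : Type u) [CStarAlgebra A]

/-- `A` is in `TA𝒞`, where the defect `1 - p` is small in the sense of comparison with `a`. -/
def IsTA : Prop :=
  ∀ (F : Finset A) (ε : ℝ), 0 < ε → ∀ a : A, IsPos a → a ≠ 0 →
    ∃ (p : A) (C : NonUnitalStarSubalgebra ℂ A), IsStarProjection p ∧ IsSubIn 𝒞 C p ∧
      (∀ x ∈ F, ‖p * x - x * p‖ ≤ ε) ∧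
      (∀ x ∈ F, Metric.infDist (p * x * p) (C : Set A) ≤ ε) ∧
      MvNBelow (1 - p) a

/-- `A` is in `TA𝒞`, where the defect `1 - p` is small in all tracial states. -/
def IsTATrace : Prop :=
  ∀ (F : Finset A) (ε : ℝ), 0 < ε →
    ∃ (p : A) (C : NonUnitalStarSubalgebra ℂ A), IsStarProjection p ∧ IsSubIn 𝒞 C p ∧
      (∀ x ∈ F, ‖p * x - x * p‖ ≤ ε) ∧
      (∀ x ∈ F, Metric.infDist (p * x * p) (C : Set A) ≤ ε) ∧
      ∀ τ : A →ₗ[ℂ] ℂ, IsTracialState 1 τ → (τ (1 - p)).re ≤ ε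

end TA

/-! ### Tracially sequentially split maps -/

section Split

variable {A B : Type u} [CStarAlgebra A] [CStarAlgebra B]

/-- `ψ : B → A_∞` is a `*`-homomorphism and `g` a projection of `A_∞ ∩ A'` with
`ψ (φ a) = a g` for all `a`. -/
structure IsApproxLeftInverse (φ : A →⋆ₙₐ[ℂ] B) (ψ : B →⋆ₙₐ[ℂ] SeqAlg A) (g : SeqAlg A) :
    Prop where
  proj : IsStarProjection g
  central : ∀ a, constSeq A a * g = g * constSeq A a
  split : ∀ a, ψ (φ a) = constSeq A a * g

/-- Tracially sequentially split `*`-homomorphisms. -/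
def IsTraciallySeqSplit (φ : A →⋆ₙₐ[ℂ] B) : Prop :=
  ∀ z : SeqAlg A, IsPos z → z ≠ 0 → ∃ (ψ : B →⋆ₙₐ[ℂ] SeqAlg A) (g : SeqAlg A),
    IsApproxLeftInverse φ ψ g ∧ g ≠ 0 ∧ MvNBelow (constSeq A 1 - g) z

/-- The variant of tracially sequentially split `*`-homomorphisms in which the defect `1 - g` is
small in all tracial states of `A_∞`. -/
def IsTraciallySeqSplitTrace (φ : A →⋆ₙₐ[ℂ] B) : Prop :=
  ∀ δ : ℝ, 0 < δ → ∃ (ψ : B →⋆ₙₐ[ℂ] SeqAlg A) (g : SeqAlg A),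
    IsApproxLeftInverse φ ψ g ∧
      ∀ τ : SeqAlg A →ₗ[ℂ] ℂ, IsTracialState (constSeq A 1) τ → (τ (constSeq A 1 - g)).re < δ

end Split

/-! ### Ranges of `*`-homomorphisms -/

section Range

variable {A D : Type u} [NonUnitalCStarAlgebra A] [NonUnitalCStarAlgebra D]

/-! The mechanism is to push an approximating algebra `C ⊂ B` into `A_∞` by `ψ`, lift to sequences
by weak semiprojectivity, and read off a late coordinate. The image of `C` in that coordinate is
only a quotient of `C`, but quotients are locally approximated by members of the class
(`IsApproxClass.exists_isSubIn_of_hom`, `IsApproxClass.exists_eventually_isSubIn`).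

The comparison form of splitting is stronger than it looks. Test it against a `z` supported on the
even coordinates: along the odd coordinates the defect `1 - g` must vanish, so after reindexing `ψ ∘
φ` is exactly the constant embedding (`IsTraciallySeqSplit.exists_leftInverse`). Hence it implies
the trace form with `g = 1`. It also gives (b) directly: `ψ` carries the approximation of `φ(F)` to
one of `F`, and the comparison `1 - q ≲ φ(a)` to `1 - ψ(q) ≲ a`, which descends to coordinates by
`eventually_mvNBelow`.

In the trace form `g = ψ(φ(1))` need not be `1`, so `C` is cut down. Its unit `q` almost commutes
with `φ(1)`, so `C` contains a projection `p` near `q φ(1)` (`exists_isStarProjection_mem_near`),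
and `pCp` is in the class. The defect `1 - ψ(p)` is small in every bounded trace of `A_∞`. An
ultrafilter limit of traces of `A` makes this uniform over `T(A)` in late coordinates
(`eventually_forall_tracialState_le`). -/

theorem NonUnitalStarAlgHom.continuous_cstar (f : D →⋆ₙₐ[ℂ] A) : Continuous f :=
  AddMonoidHomClass.continuous_of_bound f 1 fun x => by
    simpa using NonUnitalStarAlgHom.norm_apply_le f x

/-- Truncating `c` at `±‖f c‖` by functional calculus commutes with `f`, and changes nothing on the
spectrum of `f c`. -/
theorem exists_selfAdjoint_lift_norm_le (f : D →⋆ₙₐ[ℂ] A) {c : D} (hc : IsSelfAdjoint c) :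
    ∃ c', f c' = f c ∧ ‖c'‖ ≤ ‖f c‖ := by
  set r : ℝ := ‖f c‖ with hr
  have hr0 : 0 ≤ r := norm_nonneg _
  let g : ℝ → ℝ := fun t => max (-r) (min r t)
  have hg : Continuous g := by fun_prop
  have hg0 : g 0 = 0 := by simp [g, hr0]
  have hfc : IsSelfAdjoint (f c) := hc.map f
  refine ⟨cfcₙ g c, ?_, ?_⟩
  · have h1 : f (cfcₙ g c) = cfcₙ g (f c) :=
      NonUnitalStarAlgHomClass.map_cfcₙ (S := ℂ) f g c hg.continuousOn hg0
        f.continuous_cstar hc hfc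
    have h2 : cfcₙ g (f c) = cfcₙ (id : ℝ → ℝ) (f c) := by
      refine cfcₙ_congr fun t ht => ?_
      have h3 : ‖id t‖ ≤ ‖cfcₙ (id : ℝ → ℝ) (f c)‖ := norm_apply_le_norm_cfcₙ id (f c) ht
      rw [cfcₙ_id ℝ (f c), ← hr, id, Real.norm_eq_abs, abs_le] at h3
      simp [g, h3.1, h3.2]
    rw [h1, h2, cfcₙ_id ℝ (f c)]
  · refine norm_cfcₙ_le fun t _ => ?_
    rw [Real.norm_eq_abs, abs_le]
    exact ⟨le_max_left _ _, max_le (by linarith) (min_le_left _ _)⟩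

theorem exists_lift_norm_le (f : D →⋆ₙₐ[ℂ] A) (c : D) : ∃ c', f c' = f c ∧ ‖c'‖ ≤ 2 * ‖f c‖ := by
  obtain ⟨x, hx, hxn⟩ := exists_selfAdjoint_lift_norm_le f (realPart c).2
  obtain ⟨y, hy, hyn⟩ := exists_selfAdjoint_lift_norm_le f (imaginaryPart c).2
  have hre : f (realPart c : D) = (realPart (f c) : A) := by
    have h2 : ∀ x : D, f ((2⁻¹ : ℝ) • x) = (2⁻¹ : ℝ) • f x := fun x => by
      rw [← Complex.coe_smul, ← Complex.coe_smul, map_smul]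
    rw [realPart_apply_coe, realPart_apply_coe, h2, map_add, map_star]
  have him : f (imaginaryPart c : D) = (imaginaryPart (f c) : A) := by
    have h2 : ∀ x : D, f ((2⁻¹ : ℝ) • x) = (2⁻¹ : ℝ) • f x := fun x => by
      rw [← Complex.coe_smul, ← Complex.coe_smul, map_smul]
    rw [imaginaryPart_apply_coe, imaginaryPart_apply_coe, map_smul, h2, map_sub, map_star]
  refine ⟨x + Complex.I • y, ?_, ?_⟩
  · rw [map_add, map_smul, hx, hy, ← map_smul, ← map_add, realPart_add_I_smul_imaginaryPart]
  · rw [hre] at hxn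
    rw [him] at hyn
    have h1 := hxn.trans (realPart.norm_le (f c))
    have h2 := hyn.trans (imaginaryPart.norm_le (f c))
    calc ‖x + Complex.I • y‖ ≤ ‖x‖ + ‖Complex.I • y‖ := norm_add_le _ _
      _ ≤ 2 * ‖f c‖ := by rw [norm_smul, Complex.norm_I]; linarith

/-- Lifts with a uniform norm bound allow successive approximation of any point of the closure.
Closedness makes the range a C⋆-algebra, so that it counts as a quotient of `D`. -/
theorem NonUnitalStarAlgHom.isClosed_range (f : D →⋆ₙₐ[ℂ] A) : IsClosed (Set.range f) := by
  let g : NormedAddGroupHom D A := ⟨f, map_add f, 1, fun x => by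
    simpa using NonUnitalStarAlgHom.norm_apply_le f x⟩
  have hg : g.SurjectiveOnWith g.range 2 := by
    rintro _ ⟨c, rfl⟩
    exact exists_lift_norm_le f c
  refine isClosed_of_closure_subset fun y hy => ?_
  obtain ⟨x, hx, -⟩ := controlled_closure_of_complete two_pos one_pos hg y hy
  exact ⟨x, hx⟩

end Range

/-! ### Projections -/

/-- Since `|t² - t| = 1/4` at `t = 1/2`, the spectrum misses `1/2` and the step function there is
continuous on it. On either side one factor of `|t| |t - 1|` is at least `1/2`, whence the factor
`2`. -/
theorem exists_isStarProjection_norm_sub_le {D : Type u} [NonUnitalCStarAlgebra D] {c : D}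
    (hc : IsSelfAdjoint c) {η : ℝ} (hη : η < 1 / 4) (h : ‖c * c - c‖ ≤ η) :
    ∃ p : D, IsStarProjection p ∧ ‖p - c‖ ≤ 2 * η := by
  let f : ℝ → ℝ := fun t => if t < 1 / 2 then 0 else 1
  have key : ∀ t ∈ quasispectrum ℝ c, |t * t - t| ≤ η := by
    intro t ht
    have h1 := norm_apply_le_norm_cfcₙ (fun t : ℝ => t * t - t) c ht
    rw [cfcₙ_sub .., cfcₙ_mul .., cfcₙ_id' ℝ c] at h1
    exact h1.trans h
  have hne : ∀ t ∈ quasispectrum ℝ c, t ≠ 1 / 2 := by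
    rintro t ht rfl
    have := key _ ht
    norm_num at this
    linarith
  have hf : ContinuousOn f (quasispectrum ℝ c) := by
    intro t ht
    apply ContinuousAt.continuousWithinAt
    rcases lt_or_gt_of_ne (hne t ht) with h' | h'
    · refine (continuousAt_const (y := (0 : ℝ))).congr ?_
      filter_upwards [gt_mem_nhds h'] with s hs
      exact (if_pos hs).symm
    · refine (continuousAt_const (y := (1 : ℝ))).congr ?_
      filter_upwards [lt_mem_nhds h'] with s hs
      exact (if_neg (not_lt.2 (le_of_lt hs))).symm
  have hf0 : f 0 = 0 := by simp [f]
  refine ⟨cfcₙ f c, ⟨?_, cfcₙ_predicate f c⟩, ?_⟩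
  · rw [IsIdempotentElem, ← cfcₙ_mul f f c]
    refine cfcₙ_congr fun t _ => ?_
    by_cases ht : t < 1 / 2 <;> simp [f]
  · have h1 : cfcₙ f c - c = cfcₙ (fun t => f t - t) c := by
      rw [cfcₙ_sub f (fun t => t) c, cfcₙ_id' ℝ c]
    rw [h1]
    refine norm_cfcₙ_le fun t ht => ?_
    have h2 := key t ht
    have h3 : |t * t - t| = |t| * |t - 1| := by rw [← abs_mul]; ring_nf
    rw [h3] at h2
    rw [Real.norm_eq_abs]
    by_cases ht' : t < 1 / 2
    · have h4 : 1 / 2 ≤ |t - 1| := by rw [le_abs]; right; linarith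
      simp only [f, if_pos ht', zero_sub, abs_neg]
      nlinarith [abs_nonneg t]
    · have h4 : 1 / 2 ≤ |t| := by rw [le_abs]; left; linarith
      simp only [f, if_neg ht']
      rw [abs_sub_comm]
      nlinarith [abs_nonneg (t - 1)]

section Basic

variable {A : Type u} [NonUnitalCStarAlgebra A]

theorem eq_zero_of_star_mul_self_add_eq_zero {s t : A} (h : star s * s + star t * t = 0) :
    s = 0 := by
  let _ := CStarAlgebra.spectralOrder A
  have := CStarAlgebra.spectralOrderedRing A
  have h1 := (add_eq_zero_iff_of_nonneg (star_mul_self_nonneg s) (star_mul_self_nonneg t)).1 h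
  exact CStarRing.star_mul_self_eq_zero_iff s |>.1 h1.1

theorem IsUnitOf.isStarProjection {e : A} (he : IsUnitOf e) : IsStarProjection e := by
  refine ⟨(he e).1, ?_⟩
  have h := (he (star e)).1
  have := congrArg star h
  rw [star_mul, star_star] at this
  rw [h] at this
  exact this

end Basic

/-! ### Corners -/

/-- The corner `p D p` of a projection `p`. -/
def cornerSub {D : Type u} [NonUnitalCStarAlgebra D] (p : D) (hp : IsStarProjection p) :
    NonUnitalStarSubalgebra ℂ D where
  carrier := {d | p * d = d ∧ d * p = d}
  add_mem' := by
    rintro a b ⟨h1, h2⟩ ⟨h3, h4⟩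
    exact ⟨by rw [mul_add, h1, h3], by rw [add_mul, h2, h4]⟩
  zero_mem' := by simp
  mul_mem' := by
    rintro a b ⟨h1, h2⟩ ⟨h3, h4⟩
    exact ⟨by rw [← mul_assoc, h1], by rw [mul_assoc, h4]⟩
  smul_mem' := by
    rintro c a ⟨h1, h2⟩
    exact ⟨by rw [mul_smul_comm, h1], by rw [smul_mul_assoc, h2]⟩
  star_mem' := by
    rintro a ⟨h1, h2⟩
    have hs := hp.isSelfAdjoint.star_eq
    constructor
    · rw [← hs, ← star_mul, h2]
    · nth_rw 1 [← hs]
      rw [← star_mul, h1]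

theorem mem_cornerSub {D : Type u} [NonUnitalCStarAlgebra D] {p : D} {hp : IsStarProjection p}
    {d : D} : d ∈ cornerSub p hp ↔ p * d = d ∧ d * p = d := Iff.rfl

theorem isHereditarySub_cornerSub {D : Type u} [NonUnitalCStarAlgebra D] (p : D)
    (hp : IsStarProjection p) : IsHereditarySub (cornerSub p hp) where
  isClosed := by
    have : ((cornerSub p hp : NonUnitalStarSubalgebra ℂ D) : Set D)
        = {d | p * d = d} ∩ {d | d * p = d} := rfl
    rw [this]
    exact (isClosed_eq (by fun_prop) continuous_id).inter
      (isClosed_eq (by fun_prop) continuous_id)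
  hereditary := by
    rintro x y ⟨s, rfl⟩ ⟨t, ht⟩ ⟨h1, h2⟩
    have hs := hp.isSelfAdjoint.star_eq
    -- This sum is `(1 - p) y (1 - p) = 0` for `y = s*s + t*t`, so both positive summands vanish and
    -- `s = s p`.
    have h3 : star (s - s * p) * (s - s * p) + star (t - t * p) * (t - t * p) = 0 := by
      have hy : y = star s * s + star t * t := by rw [← ht]; abel
      have e : ∀ w : D, star (w - w * p) * (w - w * p)
          = star w * w - star w * w * p - p * (star w * w) + p * (star w * w * p) := by
        intro w
        rw [star_sub, star_mul, hs]
        noncomm_ring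
      rw [e, e]
      have : star s * s - star s * s * p - p * (star s * s) + p * (star s * s * p)
          + (star t * t - star t * t * p - p * (star t * t) + p * (star t * t * p))
          = y - y * p - p * y + p * (y * p) := by
        rw [hy]; noncomm_ring
      rw [this, h2, h1]
      simp
    have h4 : s * p = s := (sub_eq_zero.1 (eq_zero_of_star_mul_self_add_eq_zero h3)).symm
    have h5 : p * star s = star s := by rw [← hs, ← star_mul, h4]
    exact ⟨by rw [← mul_assoc, h5], by rw [mul_assoc, h4]⟩

/-! ### Perturbation of Murray–von Neumann subequivalence -/

/-- With `v = a z P`, the element `v*v` is invertible in the corner of `P`, so polar decomposition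
yields a partial isometry with source `P`. Its range projection lies in `aAa` because `v` starts
with `a`. -/
theorem mvNBelow_of_norm_sub_lt_one {A : Type u} [CStarAlgebra A] {a z P : A}
    (ha : IsSelfAdjoint a) (hP : IsStarProjection P)
    (h : ‖star (a * z * P) * (a * z * P) - P‖ < 1) : MvNBelow P a := by
  let _ := CStarAlgebra.spectralOrder A
  have := CStarAlgebra.spectralOrderedRing A
  set v := a * z * P with hv
  have hPP : P * P = P := hP.isIdempotentElem
  have hPs : star P = P := hP.isSelfAdjoint
  have hvP : v * P = v := by rw [hv, mul_assoc, hPP]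
  have hPv : P * star v = star v := by rw [← hPs, ← star_mul, hvP]
  -- Adding `1 - P` replaces inversion in the corner by inversion in `A`; `k` commutes with `P`,
  -- hence so does its square root `u`.
  set k := star v * v + (1 - P) with hk
  have hk0 : 0 ≤ k := add_nonneg (star_mul_self_nonneg v) hP.one_sub_nonneg
  have hkP : k * P = star v * v := by
    rw [hk, add_mul, mul_assoc, hvP, sub_mul, hPP, one_mul, sub_self, add_zero]
  have hPk : P * k = star v * v := by
    rw [hk, mul_add, ← mul_assoc, hPv, mul_sub, hPP, mul_one, sub_self, add_zero]
  have hku : IsUnit k := by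
    have h1 : k = 1 - (P - star v * v) := by rw [hk]; abel
    rw [h1]
    exact isUnit_one_sub_of_norm_lt_one (by rwa [norm_sub_rev])
  obtain ⟨u, hu⟩ := (CFC.isUnit_sqrt_iff k hk0).2 hku
  have huu : (u : A) * u = k := by rw [hu, CFC.sqrt_mul_sqrt_self k hk0]
  have hus : star (u : A) = u := by rw [hu]; exact (CFC.sqrt_nonneg k).isSelfAdjoint
  have hus' : star (↑u⁻¹ : A) = ↑u⁻¹ := by
    rw [← Units.coe_star, star_inv]
    congr 2
    exact Units.ext hus
  have huP : (u : A) * P = P * u := by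
    rw [hu]
    have hc : Commute k P := hkP.trans hPk.symm
    exact (hc.cfcₙ_nnreal _).eq
  have huP' : (↑u⁻¹ : A) * P = P * ↑u⁻¹ := by
    have : (↑u⁻¹ : A) * (u * P) * ↑u⁻¹ = ↑u⁻¹ * (P * u) * ↑u⁻¹ := by rw [huP]
    simpa [mul_assoc] using this.symm
  have h1 : star (v * ↑u⁻¹) * (v * ↑u⁻¹) = P := by
    rw [star_mul, hus', mul_assoc, ← mul_assoc (star v), ← hPk, ← huu]
    simp only [mul_assoc, Units.mul_inv, mul_one]
    rw [← huP]
    simp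
  have h2 : (v * ↑u⁻¹) * P = v * ↑u⁻¹ := by rw [mul_assoc, huP', ← mul_assoc, hvP]
  refine ⟨(v * ↑u⁻¹) * star (v * ↑u⁻¹), subset_closure ⟨z * P * ↑u⁻¹ * ↑u⁻¹ * P * star z, ?_⟩,
    ⟨?_, IsSelfAdjoint.mul_star_self _⟩, v * ↑u⁻¹, h1, rfl⟩
  · rw [star_mul, hus', hv]
    simp only [star_mul, hPs, ha.star_eq, mul_assoc]
  · rw [IsIdempotentElem, mul_assoc, ← mul_assoc (star _), h1, ← mul_assoc, h2]

/-! ### Lifting from the sequence algebra -/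

/-- The range of `j` is a quotient of `D` sitting in `A`; the approximant found inside it is
transported along the inclusion, and uniqueness of units identifies its unit with `j u`. -/
theorem IsApproxClass.exists_isSubIn_of_hom {𝒞 : CStarClass.{u}} (h𝒞 : IsApproxClass 𝒞)
    {D A : Type u} [NonUnitalCStarAlgebra D] [NonUnitalCStarAlgebra A] (hD : 𝒞 D) {u : D}
    (hu : IsUnitOf u) (j : D →⋆ₙₐ[ℂ] A) (G : Finset D) {ε : ℝ} (hε : 0 < ε) :
    ∃ E : NonUnitalStarSubalgebra ℂ A, IsSubIn 𝒞 E (j u) ∧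
      ∀ d ∈ G, Metric.infDist (j d) (E : Set A) ≤ ε := by
  classical
  let R : NonUnitalStarSubalgebra ℂ A := NonUnitalStarAlgHom.range j
  have hRc : IsClosed (R : Set A) := by
    have : (R : Set A) = Set.range j := NonUnitalStarAlgHom.coe_range j
    rw [this]
    exact j.isClosed_range
  let f : D →⋆ₙₐ[ℂ] R := NonUnitalStarAlgHom.rangeRestrict j
  have hf : Function.Surjective f := by
    rintro ⟨_, d, rfl⟩
    exact ⟨d, rfl⟩
  obtain ⟨e, C, he, hC, hG⟩ := h𝒞.quotient D R hD f hf (G.image f) ε hε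
  let ι : R →⋆ₙₐ[ℂ] A := NonUnitalStarSubalgebraClass.subtype R
  have hι : Isometry ι := isometry_subtype_coe
  have heu : e = f u := by
    obtain ⟨d, hd⟩ := hf e
    rw [← (he (f u)).1, ← hd, ← map_mul, (hu d).2]
  have hje : ι e = j u := by rw [heu]; rfl
  let E : NonUnitalStarSubalgebra ℂ A := C.map ι
  have hE : (E : Set A) = ι '' (C : Set R) := NonUnitalStarSubalgebra.coe_map C ι
  have hEc : IsClosed (E : Set A) := by
    rw [hE]
    exact (hι.isClosedEmbedding.isClosedMap) _ hC.isClosed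
  refine ⟨E, ⟨hEc, ?_, ?_, ?_, ?_⟩, ?_⟩
  · have := hC.isClosed
    let g : C →⋆ₙₐ[ℂ] E :=
      { toFun := fun c => ⟨ι c, (NonUnitalStarSubalgebra.mem_map).2 ⟨c, c.2, rfl⟩⟩
        map_smul' := fun _ _ => rfl
        map_zero' := rfl
        map_add' := fun _ _ => rfl
        map_mul' := fun _ _ => rfl
        map_star' := fun _ => rfl }
    have hg : Function.Bijective g := by
      constructor
      · intro x y hxy
        exact Subtype.ext (hι.injective (congrArg (fun z : E => (z : A)) hxy))
      · rintro ⟨_, c, hc, rfl⟩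
        exact ⟨⟨c, hc⟩, rfl⟩
    exact h𝒞.iso C E hC.mem_class ⟨StarAlgEquiv.ofBijective g hg⟩
  · exact (NonUnitalStarSubalgebra.mem_map).2 ⟨e, hC.unit_mem, hje⟩
  · rintro _ ⟨c, hc, rfl⟩
    change j u * ι c = ι c
    rw [← hje, ← map_mul, hC.unit_mul c hc]
  · rintro _ ⟨c, hc, rfl⟩
    change ι c * j u = ι c
    rw [← hje, ← map_mul, hC.mul_unit c hc]
  · intro d hd
    have h1 : Metric.infDist (ι (f d)) (ι '' (C : Set R)) = Metric.infDist (f d) (C : Set R) :=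
      Metric.infDist_image hι
    rw [hE]
    exact h1.trans_le (hG _ (Finset.mem_image_of_mem f hd))

section Sequences

variable {A : Type u} [NonUnitalCStarAlgebra A]

/-- Evaluation of a bounded sequence at `n`, as a `*`-homomorphism. -/
def lpEval (A : Type u) [NonUnitalCStarAlgebra A] (n : ℕ) : lp (fun _ : ℕ => A) ∞ →⋆ₙₐ[ℂ] A where
  toFun f := f n
  map_smul' _ _ := rfl
  map_zero' := rfl
  map_add' _ _ := rfl
  map_mul' _ _ := rfl
  map_star' _ := rfl

/-- The constant sequence, as an element of the product. -/
def lpConst (a : A) : lp (fun _ : ℕ => A) ∞ :=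
  ⟨fun _ => a, memℓp_infty ⟨‖a‖, by rintro _ ⟨n, rfl⟩; exact le_rfl⟩⟩

theorem constSeq_eq_mk (a : A) : constSeq A a = SeqCorona.mk (fun _ => A) (lpConst a) := rfl

theorem SeqCorona.mk_surjective {B : ℕ → Type u} [∀ n, NonUnitalCStarAlgebra (B n)] :
    Function.Surjective (SeqCorona.mk B) := SeqCorona.mkₗ_surjective

theorem SeqCorona.eventually_norm_mk_lt {B : ℕ → Type u} [∀ n, NonUnitalCStarAlgebra (B n)]
    (f : lp B ∞) {r : ℝ} (h : ‖SeqCorona.mk B f‖ < r) : ∀ᶠ n in atTop, ‖f n‖ < r :=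
  SeqCorona.eventually_norm_lt f h

theorem norm_constSeq_le (a : A) : ‖constSeq A a‖ ≤ ‖a‖ := by
  simpa using NonUnitalStarAlgHom.norm_apply_le (constSeq A) a

theorem constSeq_eq_zero {a : A} (h : constSeq A a = 0) : a = 0 := by
  by_contra ha
  have h1 : ‖SeqCorona.mk (fun _ => A) (lpConst a)‖ < ‖a‖ := by
    rw [← constSeq_eq_mk, h, norm_zero]
    exact norm_pos_iff.2 ha
  obtain ⟨n, hn⟩ := (SeqCorona.eventually_norm_mk_lt _ h1).exists
  exact lt_irrefl _ hn

theorem isUnitOf_constSeq_one {A : Type u} [CStarAlgebra A] : IsUnitOf (constSeq A 1) := by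
  intro x
  obtain ⟨f, rfl⟩ := SeqCorona.mk_surjective x
  rw [constSeq_eq_mk, ← map_mul, ← map_mul]
  constructor <;> congr 1 <;> ext n
  · exact one_mul (f n)
  · exact mul_one (f n)

end Sequences

/-- A `*`-homomorphism from a member of the class to `A_∞` whose unit almost commutes with a finite
set and whose range almost contains the compressions of that set yields approximating subalgebras
of `A`. -/
theorem IsApproxClass.exists_eventually_isSubIn {𝒞 : CStarClass.{u}} (h𝒞 : IsApproxClass 𝒞)
    {D A : Type u} [NonUnitalCStarAlgebra D] [CStarAlgebra A] (hD : 𝒞 D) {u : D}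
    (hu : IsUnitOf u) (f : D →⋆ₙₐ[ℂ] SeqAlg A) (F : Finset A) {ε : ℝ}
    (hcomm : ∀ x ∈ F, ‖f u * constSeq A x - constSeq A x * f u‖ < ε)
    (happrox : ∀ x ∈ F, ∃ d, ‖f u * constSeq A x * f u - f d‖ < ε) :
    ∃ P : lp (fun _ : ℕ => A) ∞, SeqCorona.mk (fun _ => A) P = f u ∧
      (∀ n, IsStarProjection (P n)) ∧
      ∀ᶠ n in atTop, ∃ C : NonUnitalStarSubalgebra ℂ A, IsSubIn 𝒞 C (P n) ∧
        (∀ x ∈ F, ‖P n * x - x * P n‖ ≤ ε) ∧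
        ∀ x ∈ F, Metric.infDist (P n * x * P n) (C : Set A) ≤ ε := by
  classical
  obtain ⟨k, hk⟩ := h𝒞.weaklySemiprojective D hD (fun _ => A) f
  choose! d hd using happrox
  refine ⟨k u, hk u, fun n => ?_, ?_⟩
  · exact (hu.isStarProjection.map k).map (lpEval A n)
  have h1 : ∀ᶠ n in atTop, ∀ x ∈ F, ‖k u n * x - x * k u n‖ < ε := by
    refine (Filter.eventually_all_finset F).2 fun x hx => ?_
    refine SeqCorona.eventually_norm_mk_lt (k u * lpConst x - lpConst x * k u) ?_
    rw [map_sub, map_mul, map_mul, hk, ← constSeq_eq_mk]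
    exact hcomm x hx
  have h2 : ∀ᶠ n in atTop, ∀ x ∈ F, ‖k u n * x * k u n - k (d x) n‖ < ε := by
    refine (Filter.eventually_all_finset F).2 fun x hx => ?_
    refine SeqCorona.eventually_norm_mk_lt (k u * lpConst x * k u - k (d x)) ?_
    rw [map_sub, map_mul, map_mul, hk, hk, ← constSeq_eq_mk]
    exact hd x hx
  filter_upwards [h1, h2] with n hn1 hn2
  -- Finiteness of `F` turns the strict inequalities into a margin `η`, which pays for approximating
  -- the image algebra in coordinate `n`.
  have hex : ∃ η > 0, ∀ x ∈ F, ‖k u n * x * k u n - k (d x) n‖ ≤ ε - η := by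
    rcases F.eq_empty_or_nonempty with rfl | hF
    · exact ⟨1, one_pos, by simp⟩
    · obtain ⟨x, hx, hmax⟩ := F.exists_max_image (fun x => ‖k u n * x * k u n - k (d x) n‖) hF
      exact ⟨ε - ‖k u n * x * k u n - k (d x) n‖, sub_pos.2 (hn2 x hx), fun y hy => by
        rw [sub_sub_cancel]; exact hmax y hy⟩
  obtain ⟨η, hη, hle⟩ := hex
  obtain ⟨E, hE, hdist⟩ := h𝒞.exists_isSubIn_of_hom hD hu ((lpEval A n).comp k) (F.image d) hη
  refine ⟨E, hE, fun x hx => (hn1 x hx).le, fun x hx => ?_⟩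
  have h3 : Metric.infDist (k (d x) n) (E : Set A) ≤ η := hdist _ (Finset.mem_image_of_mem d hx)
  have h4 := Metric.infDist_le_infDist_add_dist (s := (E : Set A)) (x := k u n * x * k u n)
    (y := k (d x) n)
  rw [dist_eq_norm] at h4
  linarith [hle x hx]

/-- Murray–von Neumann subequivalence to a constant in `A_∞` passes to representing sequences. -/
theorem eventually_mvNBelow {A : Type u} [CStarAlgebra A] {a : A} (ha : IsSelfAdjoint a)
    {Q : lp (fun _ : ℕ => A) ∞} (hQ : ∀ n, IsStarProjection (Q n))
    (h : MvNBelow (SeqCorona.mk (fun _ => A) Q) (constSeq A a)) :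
    ∀ᶠ n in atTop, MvNBelow (Q n) a := by
  obtain ⟨r, hr, -, w, hw, hw'⟩ := h
  set q := SeqCorona.mk (fun _ => A) Q with hq
  have hqq : q * q = q := by
    rw [hq, ← map_mul]
    congr 1
    ext n
    exact (hQ n).isIdempotentElem
  have hqs : star q = q := by
    rw [hq, ← map_star]
    congr 1
    ext n
    exact (hQ n).isSelfAdjoint
  -- `‖T x‖ < 1` is an open condition holding at `r`, so the limit `r` can be replaced by some `a y
  -- a`, whose coordinates meet the perturbation criterion.
  let T : SeqAlg A → SeqAlg A := fun x => star (x * w * q) * (x * w * q) - q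
  have hT : Continuous T := by fun_prop
  have hTr : T r = 0 := by
    have h1 : r * w * q = w * q := by
      rw [← hw', mul_assoc w, hw, mul_assoc, hqq]
    simp only [T, h1]
    rw [star_mul, hqs, mul_assoc, ← mul_assoc (star w), hw, hqq, hqq, sub_self]
  have hopen : IsOpen (T ⁻¹' Metric.ball 0 1) := Metric.isOpen_ball.preimage hT
  obtain ⟨_, hx, y, rfl⟩ := mem_closure_iff.1 hr _ hopen (by simp [hTr])
  obtain ⟨Y, rfl⟩ := SeqCorona.mk_surjective y
  obtain ⟨W, rfl⟩ := SeqCorona.mk_surjective w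
  have hx' : ‖T (constSeq A a * SeqCorona.mk (fun _ => A) Y * constSeq A a)‖ < 1 := by
    simpa using hx
  simp only [T, constSeq_eq_mk, hq, ← map_mul, ← map_star, ← map_sub] at hx'
  filter_upwards [SeqCorona.eventually_norm_mk_lt _ hx'] with n hn
  refine mvNBelow_of_norm_sub_lt_one (z := Y n * a * W n) ha (hQ n) ?_
  have e : a * (Y n * a * W n) * Q n = a * Y n * a * W n * Q n := by simp only [mul_assoc]
  rw [e]
  exact hn

theorem MvNBelow.map {A B : Type u} [NonUnitalCStarAlgebra A] [NonUnitalCStarAlgebra B]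
    (f : A →⋆ₙₐ[ℂ] B) {p a : A} (h : MvNBelow p a) : MvNBelow (f p) (f a) := by
  obtain ⟨r, hr, hrp, w, hw, hw'⟩ := h
  refine ⟨f r, ?_, hrp.map f, f w, by rw [← map_star, ← map_mul, hw],
    by rw [← map_star, ← map_mul, hw']⟩
  refine map_mem_closure f.continuous_cstar hr ?_
  rintro _ ⟨x, rfl⟩
  exact ⟨f x, by simp only [map_mul]⟩

/-! ### Passing to subsequences -/

section Reindex

variable {A : Type u} [NonUnitalCStarAlgebra A]

/-- Passage to a subsequence on the product. -/
def lpReindex (s : ℕ → ℕ) : lp (fun _ : ℕ => A) ∞ →ₗ[ℂ] lp (fun _ : ℕ => A) ∞ where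
  toFun f := ⟨fun n => f (s n), memℓp_infty ⟨‖f‖, by
    rintro _ ⟨n, rfl⟩
    exact lp.norm_apply_le_norm ENNReal.top_ne_zero f (s n)⟩⟩
  map_add' _ _ := rfl
  map_smul' _ _ := rfl

/-- Passage to a subsequence, as a `*`-endomorphism of `A_∞`. -/
noncomputable def seqReindex (A : Type u) [NonUnitalCStarAlgebra A] (s : ℕ → ℕ)
    (hs : Tendsto s atTop atTop) : SeqAlg A →⋆ₙₐ[ℂ] SeqAlg A :=
  let L : SeqAlg A →ₗ[ℂ] SeqAlg A :=
    (c0Seq fun _ : ℕ => A).liftQ (SeqCorona.mkₗ ∘ₗ lpReindex s) fun f hf => by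
      have h : lpReindex (A := A) s f - 0 ∈ c0Seq fun _ : ℕ => A := by
        rw [sub_zero]
        exact (mem_c0Seq.1 hf).comp hs
      exact (SeqCorona.mkₗ_eq_iff.2 h).trans (map_zero _)
  { toFun := L
    map_smul' := map_smul L
    map_zero' := map_zero L
    map_add' := map_add L
    map_mul' := fun x y => by
      obtain ⟨f, rfl⟩ := SeqCorona.mkₗ_surjective x
      obtain ⟨g, rfl⟩ := SeqCorona.mkₗ_surjective y
      rfl
    map_star' := fun x => by
      obtain ⟨f, rfl⟩ := SeqCorona.mkₗ_surjective x
      rfl }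

theorem seqReindex_mk (s : ℕ → ℕ) (hs : Tendsto s atTop atTop) (f : lp (fun _ : ℕ => A) ∞) :
    seqReindex A s hs (SeqCorona.mk _ f) = SeqCorona.mk _ (lpReindex (A := A) s f) := rfl

theorem seqReindex_constSeq (s : ℕ → ℕ) (hs : Tendsto s atTop atTop) (a : A) :
    seqReindex A s hs (constSeq A a) = constSeq A a := rfl

end Reindex

/-! ### Exact left inverses from the comparison form -/

section Split

variable {A B : Type u} [CStarAlgebra A] [CStarAlgebra B] {φ : A →⋆ₙₐ[ℂ] B}

/-- Testing against a `z` supported on the even coordinates removes the defect along the odd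
coordinates. -/
theorem IsTraciallySeqSplit.exists_leftInverse [Nontrivial A] (h : IsTraciallySeqSplit φ) :
    ∃ ψ : B →⋆ₙₐ[ℂ] SeqAlg A, ∀ a, ψ (φ a) = constSeq A a := by
  let Z : lp (fun _ : ℕ => A) ∞ := ⟨fun n => if Even n then 1 else 0, memℓp_infty ⟨‖(1 : A)‖, by
    rintro _ ⟨n, rfl⟩
    by_cases hn : Even n <;> simp [hn]⟩⟩
  have hZ : ∀ n, Z n = if Even n then 1 else 0 := fun n => rfl
  have hs : Tendsto (fun n : ℕ => 2 * n) atTop atTop :=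
    tendsto_atTop_mono (fun n => by change n ≤ _; omega) tendsto_id
  have ht : Tendsto (fun n : ℕ => 2 * n + 1) atTop atTop :=
    tendsto_atTop_mono (fun n => by change n ≤ _; omega) tendsto_id
  have hpos : IsPos (SeqCorona.mk _ Z) := by
    refine ⟨SeqCorona.mk _ Z, ?_⟩
    rw [← map_star, ← map_mul]
    congr 1
    ext n
    change Z n = star (Z n) * Z n
    by_cases hn : Even n <;> simp [hZ, hn]
  have heven : seqReindex A _ hs (SeqCorona.mk _ Z) = constSeq A 1 := by
    rw [seqReindex_mk, constSeq_eq_mk]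
    congr 1
    ext n
    change Z (2 * n) = 1
    simp [hZ]
  have hodd : seqReindex A _ ht (SeqCorona.mk _ Z) = 0 := by
    rw [seqReindex_mk, ← map_zero (SeqCorona.mk _)]
    congr 1
    ext n
    change Z (2 * n + 1) = 0
    simp [hZ]
  have hne : SeqCorona.mk _ Z ≠ 0 := by
    intro h0
    rw [h0, map_zero] at heven
    exact one_ne_zero (constSeq_eq_zero heven.symm)
  obtain ⟨ψ, g, hψ, -, hg⟩ := h _ hpos hne
  have hg' := hg.map (seqReindex A _ ht)
  rw [hodd, map_sub, seqReindex_constSeq] at hg'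
  obtain ⟨r, hr, -, w, hw, hw'⟩ := hg'
  -- The hereditary subalgebra generated by `0` is zero, so the reindexed defect is equivalent to
  -- `0`.
  have hr0 : r = 0 := by simpa [herSet] using hr
  have hw0 : w = 0 := CStarRing.mul_star_self_eq_zero_iff w |>.1 (hw'.trans hr0)
  have hg1 : seqReindex A _ ht g = constSeq A 1 := by
    rw [hw0, mul_zero] at hw
    exact (sub_eq_zero.1 hw.symm).symm
  refine ⟨(seqReindex A _ ht).comp ψ, fun a => ?_⟩
  change seqReindex A _ ht (ψ (φ a)) = _
  rw [hψ.split, map_mul, hg1, seqReindex_constSeq, ← map_mul, mul_one]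

theorem IsTraciallySeqSplit.traceForm (h : IsTraciallySeqSplit φ) :
    IsTraciallySeqSplitTrace φ := by
  intro δ hδ
  rcases subsingleton_or_nontrivial A with hA | hA
  -- For `A = 0` there is no nonzero `z` to test with, but zero maps suffice.
  · have h0 : ∀ a, constSeq A a = 0 := fun a => by rw [Subsingleton.elim a 0, map_zero]
    exact ⟨0, 0, ⟨.zero _, by simp, by simp⟩, by simp [h0, hδ]⟩
  · obtain ⟨ψ, hψ⟩ := h.exists_leftInverse
    have hu : IsUnitOf (constSeq A 1) := isUnitOf_constSeq_one
    refine ⟨ψ, constSeq A 1, ⟨hu.isStarProjection, fun a => ?_, fun a => ?_⟩, fun τ _ => ?_⟩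
    · rw [(hu _).1, (hu _).2]
    · rw [hψ, (hu _).2]
    · simpa using hδ

end Split

/-! ### Traces -/

section Trace

open scoped ComplexOrder

/-- The constant `4` counts the positive parts of `x`. Only its uniformity in `τ` matters: it gives
compactness for limits of traces and controls norm perturbations. -/
theorem IsTracialState.norm_apply_le {A : Type u} [CStarAlgebra A] {τ : A →ₗ[ℂ] ℂ}
    (hτ : IsTracialState 1 τ) (x : A) : ‖τ x‖ ≤ 4 * ‖x‖ := by
  let _ := CStarAlgebra.spectralOrder A
  have := CStarAlgebra.spectralOrderedRing A
  let T : A →ₚ[ℂ] ℂ := PositiveLinearMap.mk₀ τ fun y hy => by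
    obtain ⟨s, rfl⟩ := CStarAlgebra.nonneg_iff_eq_star_mul_self.1 hy
    exact hτ.nonneg s
  have hT : ∀ y, 0 ≤ y → ‖τ y‖ ≤ ‖y‖ := fun y hy => by
    have h1 := PositiveLinearMap.norm_apply_le_of_nonneg T y hy
    have h2 : T 1 = 1 := hτ.map_unit
    rw [h2, norm_one, one_mul] at h1
    exact h1
  obtain ⟨y, hy0, hyn, hy⟩ := CStarAlgebra.exists_sum_four_nonneg x
  conv_lhs => rw [hy]
  simp only [map_sum, map_smul]
  calc ‖∑ i : Fin 4, Complex.I ^ (i : ℕ) • τ (y i)‖ ≤ ∑ i : Fin 4, ‖x‖ := by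
        refine (norm_sum_le _ _).trans (Finset.sum_le_sum fun i _ => ?_)
        rw [norm_smul, norm_pow, Complex.norm_I, one_pow, one_mul]
        exact (hT _ (hy0 i)).trans (hyn i)
    _ = 4 * ‖x‖ := by simp

/-- A bound valid for all bounded tracial states of `A_∞` holds eventually, uniformly over the
tracial states of `A`. -/
theorem eventually_forall_tracialState_le {A : Type u} [CStarAlgebra A]
    (f : lp (fun _ : ℕ => A) ∞) {ε : ℝ}
    (h : ∀ τ : SeqAlg A →ₗ[ℂ] ℂ, IsTracialState (constSeq A 1) τ → (∀ y, ‖τ y‖ ≤ 4 * ‖y‖) →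
      (τ (SeqCorona.mk _ f)).re < ε) :
    ∀ᶠ n in atTop, ∀ τ : A →ₗ[ℂ] ℂ, IsTracialState 1 τ → (τ (f n)).re ≤ ε := by
  classical
  by_contra hcon
  let S : Set ℕ := {n | ∃ τ : A →ₗ[ℂ] ℂ, IsTracialState 1 τ ∧ ε < (τ (f n)).re}
  have hS : ∃ᶠ n in atTop, n ∈ S := by
    refine (not_eventually.1 hcon).mono fun n hn => ?_
    push Not at hn
    exact hn
  have hNe : NeBot (atTop ⊓ 𝓟 S) := frequently_mem_iff_neBot.1 hS
  -- A free ultrafilter concentrated on the bad coordinates: the limit along it of the violating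
  -- traces contradicts `h`.
  let U : Ultrafilter ℕ := Ultrafilter.of (atTop ⊓ 𝓟 S)
  have hU : (U : Filter ℕ) ≤ atTop := (Ultrafilter.of_le _).trans inf_le_left
  have hUS : ∀ᶠ n in (U : Filter ℕ), n ∈ S :=
    le_principal_iff.1 ((Ultrafilter.of_le _).trans inf_le_right)
  have hT : ∀ n, ∃ τ : A →ₗ[ℂ] ℂ, n ∈ S → IsTracialState 1 τ ∧ ε < (τ (f n)).re := by
    intro n
    by_cases hn : n ∈ S
    · obtain ⟨τ, hτ⟩ := hn
      exact ⟨τ, fun _ => hτ⟩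
    · exact ⟨0, fun h' => absurd h' hn⟩
  choose T hT using hT
  have hex : ∀ g : lp (fun _ : ℕ => A) ∞, ∃ l : ℂ, Tendsto (fun n => T n (g n)) U (𝓝 l) := by
    intro g
    have hK : IsCompact (Metric.closedBall (0 : ℂ) (4 * ‖g‖)) := isCompact_closedBall _ _
    obtain ⟨l, -, hl⟩ := hK.ultrafilter_le_nhds (U.map fun n => T n (g n)) (by
      rw [le_principal_iff]
      change ∀ᶠ n in (U : Filter ℕ), T n (g n) ∈ Metric.closedBall (0 : ℂ) (4 * ‖g‖)
      filter_upwards [hUS] with n hn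
      rw [mem_closedBall_zero_iff]
      refine ((hT n hn).1.norm_apply_le _).trans ?_
      have := lp.norm_apply_le_norm ENNReal.top_ne_zero g n
      linarith)
    exact ⟨l, hl⟩
  choose l hl using hex
  let Λ : lp (fun _ : ℕ => A) ∞ →ₗ[ℂ] ℂ :=
    { toFun := l
      map_add' := fun g g' => tendsto_nhds_unique (hl (g + g')) (by
        refine ((hl g).add (hl g')).congr fun n => ?_
        exact (map_add (T n) _ _).symm)
      map_smul' := fun c g => tendsto_nhds_unique (hl (c • g)) (by
        refine ((hl g).const_mul c).congr fun n => ?_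
        exact (map_smul (T n) c _).symm) }
  -- Bounding by the quotient norm makes the limit functional vanish on `c₀`, so it descends to
  -- `A_∞`.
  have hΛ : ∀ g, ∀ r, ‖SeqCorona.mk (fun _ => A) g‖ < r → ‖l g‖ ≤ 4 * r := by
    intro g r hr
    refine le_of_tendsto (hl g).norm ?_
    filter_upwards [hUS, hU (SeqCorona.eventually_norm_mk_lt g hr)] with n hn hn'
    have hn'' : ‖g n‖ < r := hn'
    exact ((hT n hn).1.norm_apply_le _).trans (by linarith)
  have hΛ' : ∀ g, ‖l g‖ ≤ 4 * ‖SeqCorona.mk (fun _ => A) g‖ := by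
    intro g
    have : ‖l g‖ / 4 ≤ ‖SeqCorona.mk (fun _ => A) g‖ :=
      le_of_forall_gt_imp_ge_of_dense fun r hr => by linarith [hΛ g r hr]
    linarith
  let τ : SeqAlg A →ₗ[ℂ] ℂ := (c0Seq fun _ : ℕ => A).liftQ Λ fun g hg => by
    have h1 : SeqCorona.mk (fun _ => A) g = 0 := by
      have h2 : g - 0 ∈ c0Seq fun _ : ℕ => A := by rwa [sub_zero]
      exact (SeqCorona.mkₗ_eq_iff.2 h2).trans (map_zero _)
    have h3 := hΛ' g
    rw [h1, norm_zero, mul_zero] at h3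
    exact norm_le_zero_iff.1 h3
  have hτ : ∀ g, τ (SeqCorona.mk _ g) = l g := fun g => rfl
  have htr : IsTracialState (constSeq A 1) τ := by
    refine ⟨fun x => ?_, ?_, fun x y => ?_⟩
    · obtain ⟨g, rfl⟩ := SeqCorona.mk_surjective x
      rw [← map_star, ← map_mul, hτ]
      refine ge_of_tendsto (hl _) ?_
      filter_upwards [hUS] with n hn
      exact (hT n hn).1.nonneg (g n)
    · rw [constSeq_eq_mk, hτ]
      refine tendsto_nhds_unique (hl _) (tendsto_const_nhds.congr' ?_)
      filter_upwards [hUS] with n hn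
      exact (hT n hn).1.map_unit.symm
    · obtain ⟨g, rfl⟩ := SeqCorona.mk_surjective x
      obtain ⟨g', rfl⟩ := SeqCorona.mk_surjective y
      rw [← map_mul, ← map_mul, hτ, hτ]
      refine tendsto_nhds_unique (hl _) ((hl _).congr' ?_)
      filter_upwards [hUS] with n hn
      exact ((hT n hn).1.tracial (g n) (g' n)).symm
  have hlt := h τ htr fun y => by
    obtain ⟨g, rfl⟩ := SeqCorona.mk_surjective y
    exact hΛ' g
  refine hlt.not_ge ?_
  rw [hτ]
  refine ge_of_tendsto ((Complex.continuous_re.tendsto _).comp (hl f)) ?_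
  filter_upwards [hUS] with n hn
  exact (hT n hn).2.le

theorem IsTracialState.re_nonneg_of_isStarProjection {S : Type u} [NonUnitalCStarAlgebra S]
    {e : S} {τ : S →ₗ[ℂ] ℂ} (hτ : IsTracialState e τ) {p : S} (hp : IsStarProjection p) :
    0 ≤ (τ p).re := by
  have h := hτ.nonneg p
  rw [hp.isSelfAdjoint.star_eq, hp.isIdempotentElem] at h
  exact (Complex.nonneg_iff.1 h).1

/-- A bound on a projection in all tracial states of `B` persists under `*`-homomorphisms into
algebras with tracial states. -/
theorem IsTracialState.re_map_le {S B : Type u} [NonUnitalCStarAlgebra S] [CStarAlgebra B] {e : S}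
    {τ : S →ₗ[ℂ] ℂ} (hτ : IsTracialState e τ) (he : IsUnitOf e) (ψ : B →⋆ₙₐ[ℂ] S) {b : B}
    (hb : IsStarProjection b) {r : ℝ} (hr : 0 ≤ r)
    (h : ∀ σ : B →ₗ[ℂ] ℂ, IsTracialState 1 σ → (σ b).re ≤ r) : (τ (ψ b)).re ≤ r := by
  have hp1 : IsStarProjection (ψ 1) := (IsStarProjection.one B).map ψ
  have ht : 0 ≤ τ (ψ 1) := by
    have := hτ.nonneg (ψ 1)
    rwa [hp1.isSelfAdjoint.star_eq, hp1.isIdempotentElem] at this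
  obtain ⟨ht0, htim⟩ := Complex.nonneg_iff.1 ht
  have ht1 : (τ (ψ 1)).re ≤ 1 := by
    have h1 : IsStarProjection (e - ψ 1) := by
      refine ⟨?_, he.isStarProjection.isSelfAdjoint.sub hp1.isSelfAdjoint⟩
      rw [IsIdempotentElem, sub_mul, mul_sub, mul_sub, (he e).1, (he _).1, (he _).2,
        hp1.isIdempotentElem]
      abel
    have h2 := hτ.re_nonneg_of_isStarProjection h1
    rw [map_sub, hτ.map_unit, Complex.sub_re, Complex.one_re] at h2
    linarith
  -- If `τ(ψ(1)) = 0`, then `ψ(b) ≤ ψ(1)` has trace at most `0`. Otherwise `τ ∘ ψ` normalised is a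
  -- tracial state of `B`, and the normalising factor `τ(ψ(1)) ≤ 1` only helps.
  rcases eq_or_ne (τ (ψ 1)) 0 with h0 | h0
  · have h2 := hτ.re_nonneg_of_isStarProjection (hb.one_sub.map ψ)
    rw [map_sub, map_sub, h0, zero_sub, Complex.neg_re] at h2
    linarith
  · set t := τ (ψ 1) with htdef
    have htre : t = (t.re : ℂ) := Complex.ext rfl (by simp [← htim])
    have htpos : 0 < t.re := lt_of_le_of_ne ht0 fun h' => h0 (by rw [htre, ← h']; simp)
    let σ : B →ₗ[ℂ] ℂ :=
      { toFun := fun x => t⁻¹ * τ (ψ x)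
        map_add' := fun x y => by rw [map_add, map_add, mul_add]
        map_smul' := fun c x => by
          rw [map_smul, map_smul, smul_eq_mul, smul_eq_mul, RingHom.id_apply]; ring }
    have hσ : ∀ x, σ x = t⁻¹ * τ (ψ x) := fun x => rfl
    have hσt : IsTracialState 1 σ := by
      refine ⟨fun x => ?_, inv_mul_cancel₀ h0, fun x y => ?_⟩
      · rw [hσ, map_mul ψ, map_star ψ]
        refine mul_nonneg ?_ (hτ.nonneg _)
        rw [htre, ← Complex.ofReal_inv]
        exact_mod_cast (inv_pos.2 htpos).le
      · rw [hσ, hσ, map_mul ψ, map_mul ψ, hτ.tracial]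
    have h1 := h σ hσt
    rw [hσ, htre, ← Complex.ofReal_inv, Complex.re_ofReal_mul, inv_mul_le_iff₀ htpos] at h1
    nlinarith

end Trace

/-! ### Cutting down approximants, and the permanence theorems -/

theorem exists_norm_sub_lt_of_infDist_le {S : Type u} [NonUnitalCStarAlgebra S]
    (C : NonUnitalStarSubalgebra ℂ S) {y : S} {ε ε' : ℝ}
    (h : Metric.infDist y (C : Set S) ≤ ε) (hε : ε < ε') : ∃ c ∈ C, ‖y - c‖ < ε' := by
  obtain ⟨c, hc, hd⟩ := (Metric.infDist_lt_iff ⟨0, zero_mem C⟩).1 (h.trans_lt hε)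
  exact ⟨c, hc, by rwa [← dist_eq_norm]⟩

/-- If the unit `q` of `C` almost commutes with a projection `e` and `C` almost contains `q e q`,
then `C` contains a projection close to `q e`. -/
theorem exists_isStarProjection_mem_near {S : Type u} [NonUnitalCStarAlgebra S] {q e : S}
    (hq : IsStarProjection q) (he : IsStarProjection e) (C : NonUnitalStarSubalgebra ℂ S)
    (hC : IsClosed (C : Set S)) {ε : ℝ} (hε : 0 < ε) (hε1 : ε ≤ 1 / 100)
    (hcomm : ‖q * e - e * q‖ ≤ ε) (hdist : Metric.infDist (q * e * q) (C : Set S) ≤ ε) :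
    ∃ p ∈ C, IsStarProjection p ∧ ‖p - q * e‖ ≤ 25 * ε ∧ ‖p - e * q‖ ≤ 25 * ε := by
  obtain ⟨c₀, hc₀, hd⟩ := exists_norm_sub_lt_of_infDist_le C hdist (by linarith : ε < 2 * ε)
  have hqs := hq.isSelfAdjoint.star_eq
  have hes := he.isSelfAdjoint.star_eq
  have hqq : q * q = q := hq.isIdempotentElem
  have hee : e * e = e := he.isIdempotentElem
  have hq1 : ‖q‖ ≤ 1 := hq.norm_le
  have he1 : ‖e‖ ≤ 1 := he.norm_le
  set y := q * e * q with hy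
  have hys : star y = y := by rw [hy, star_mul, star_mul, hqs, hes, mul_assoc]
  have hy1 : ‖y‖ ≤ 1 := by
    calc ‖y‖ ≤ ‖q‖ * ‖e‖ * ‖q‖ := norm_mul₃_le
      _ ≤ 1 * 1 * 1 := by gcongr
      _ = 1 := by norm_num
  have hyy : ‖y * y - y‖ ≤ ε := by
    have h1 : y * y - y = q * (e * (q * e - e * q) * q) := by
      have h2 : y * y = q * (e * (q * e) * q) := by
        rw [hy]
        calc q * e * q * (q * e * q) = q * e * (q * q) * e * q := by simp only [mul_assoc]
          _ = _ := by rw [hqq]; simp only [mul_assoc]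
      have h3 : y = q * (e * (e * q) * q) := by
        rw [hy]
        calc q * e * q = q * (e * e) * (q * q) := by rw [hqq, hee]
          _ = _ := by simp only [mul_assoc]
      calc y * y - y = q * (e * (q * e) * q) - q * (e * (e * q) * q) := by rw [h2, ← h3]
        _ = _ := by rw [mul_sub, sub_mul, mul_sub]
    rw [h1]
    calc ‖q * (e * (q * e - e * q) * q)‖ ≤ ‖q‖ * (‖e‖ * ‖q * e - e * q‖ * ‖q‖) :=
          (norm_mul_le _ _).trans (by gcongr; exact norm_mul₃_le)
      _ ≤ 1 * (1 * ε * 1) := by gcongr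
      _ = ε := by ring
  let c : S := (2⁻¹ : ℂ) • (c₀ + star c₀)
  have hcC : c ∈ C := SMulMemClass.smul_mem _ (add_mem hc₀ (star_mem hc₀))
  have hcs : star c = c := by
    simp only [c, star_smul, star_add, star_star]
    rw [add_comm]
    congr 1
    simp
  have hyc : ‖y - c‖ ≤ 2 * ε := by
    have h1 : y - c = (2⁻¹ : ℂ) • ((y - c₀) + star (y - c₀)) := by
      rw [star_sub, hys]
      simp only [c]
      module
    rw [h1, norm_smul]
    have h2 := norm_add_le (y - c₀) (star (y - c₀))
    rw [norm_star] at h2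
    have h3 : ‖(2⁻¹ : ℂ)‖ = 2⁻¹ := by simp
    rw [h3]
    linarith
  have hc1 : ‖c‖ ≤ 1 + 2 * ε := by
    have := norm_sub_le y (y - c)
    rw [sub_sub_cancel] at this
    linarith
  -- The terms add up to `7ε + 4ε² ≤ 11ε`, below `1/4` as `ε ≤ 1/100`. Rounding `c` costs `22ε`,
  -- passing from `c` to `q e q` another `2ε`, and from there to `q e` or `e q` a last `ε`.
  have hcc : ‖c * c - c‖ ≤ 11 * ε := by
    have h1 : c * c - c = (y * y - y) - (y - c) * y - c * (y - c) + (y - c) := by noncomm_ring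
    have h2 : ‖(y - c) * y‖ ≤ 2 * ε * 1 := (norm_mul_le _ _).trans (by gcongr)
    have h3 : ‖c * (y - c)‖ ≤ (1 + 2 * ε) * (2 * ε) := (norm_mul_le _ _).trans (by gcongr)
    rw [h1]
    have h4 := norm_add_le ((y * y - y) - (y - c) * y - c * (y - c)) (y - c)
    have h5 := norm_sub_le ((y * y - y) - (y - c) * y) (c * (y - c))
    have h6 := norm_sub_le (y * y - y) ((y - c) * y)
    nlinarith
  -- The functional calculus is performed inside `C`, so the projection stays in `C`.
  obtain ⟨p, hp, hpc⟩ := exists_isStarProjection_norm_sub_le (D := C) (c := ⟨c, hcC⟩)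
    (η := 11 * ε) (Subtype.ext hcs) (by linarith) hcc
  have hpc' : ‖(p : S) - c‖ ≤ 2 * (11 * ε) := hpc
  have hpy : ‖(p : S) - y‖ ≤ 24 * ε := by
    have h1 : (p : S) - y = (p - c) - (y - c) := by abel
    rw [h1]
    linarith [norm_sub_le ((p : S) - c) (y - c)]
  refine ⟨p, p.2, hp.map (NonUnitalStarSubalgebraClass.subtype C), ?_, ?_⟩
  · have h1 : y - q * e = - (q * (q * e - e * q)) := by
      rw [mul_sub, ← mul_assoc q q, hqq, ← mul_assoc, neg_sub]
    have h2 : ‖y - q * e‖ ≤ 1 * ε := by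
      rw [h1, norm_neg]
      exact (norm_mul_le _ _).trans (by gcongr)
    have h3 := norm_add_le ((p : S) - y) (y - q * e)
    rw [sub_add_sub_cancel] at h3
    linarith
  · have h1 : y - e * q = (q * e - e * q) * q := by rw [sub_mul, mul_assoc e, hqq]
    have h2 : ‖y - e * q‖ ≤ ε * 1 := by
      rw [h1]
      exact (norm_mul_le _ _).trans (by gcongr)
    have h3 := norm_add_le ((p : S) - y) (y - e * q)
    rw [sub_add_sub_cancel] at h3
    linarith

theorem IsTATrace.of_traceSplit {𝒞 : CStarClass.{u}} (h𝒞 : IsApproxClass 𝒞) {A B : Type u}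
    [CStarAlgebra A] [CStarAlgebra B] {φ : A →⋆ₙₐ[ℂ] B} (hφ : IsTraciallySeqSplitTrace φ)
    (hB : IsTATrace 𝒞 B) : IsTATrace 𝒞 A := by
  classical
  intro F ε hε
  obtain ⟨M, hM0, hM⟩ : ∃ M : ℝ, 0 ≤ M ∧ ∀ x ∈ F, ‖x‖ ≤ M := by
    refine ⟨∑ x ∈ F, ‖x‖, Finset.sum_nonneg fun _ _ => norm_nonneg _, fun x hx => ?_⟩
    exact Finset.single_le_sum (f := fun x : A => ‖x‖) (fun _ _ => norm_nonneg _) hx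
  -- The commutator estimate costs `(50M + 1)η`, and the trace estimate `101η` beyond the splitting
  -- defect `ε/4`; hence `202`.
  obtain ⟨η, hη, hη1, hηε⟩ : ∃ η : ℝ, 0 < η ∧ η ≤ 1 / 100 ∧ (50 * M + 202) * η ≤ ε / 2 := by
    refine ⟨min (1 / 100) (ε / 2 / (50 * M + 202)), by positivity, min_le_left _ _, ?_⟩
    have : 0 < 50 * M + 202 := by positivity
    calc (50 * M + 202) * _ ≤ (50 * M + 202) * (ε / 2 / (50 * M + 202)) := by
          gcongr; exact min_le_right _ _
      _ = ε / 2 := by field_simp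
  obtain ⟨ψ, g, hψ, hg⟩ := hφ (ε / 4) (by positivity)
  -- Including `φ 1` in the finite set is what allows `C` to be cut by it.
  obtain ⟨q, C, hq, hC, hcomm, hdist, htr⟩ := hB (insert (φ 1) (F.image φ)) η hη
  have he : IsStarProjection (φ 1) := (IsStarProjection.one A).map φ
  have hu : IsUnitOf (constSeq A 1) := isUnitOf_constSeq_one
  have hψe : ψ (φ 1) = g := by rw [hψ.split, (hu g).1]
  obtain ⟨p, hpC, hp, hpqe, hpeq⟩ := exists_isStarProjection_mem_near hq he C hC.isClosed hη hη1
    (hcomm _ (Finset.mem_insert_self _ _)) (hdist _ (Finset.mem_insert_self _ _))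
  have hCc := hC.isClosed
  have hp' : IsStarProjection (⟨p, hpC⟩ : C) :=
    ⟨Subtype.ext hp.isIdempotentElem, Subtype.ext hp.isSelfAdjoint⟩
  let H : NonUnitalStarSubalgebra ℂ C := cornerSub ⟨p, hpC⟩ hp'
  have hH : IsHereditarySub H := isHereditarySub_cornerSub _ _
  have hHc : IsClosed (H : Set C) := hH.isClosed
  let v : H := ⟨⟨p, hpC⟩, mem_cornerSub.2 ⟨hp'.isIdempotentElem, hp'.isIdempotentElem⟩⟩
  have hv : IsUnitOf v := fun x => ⟨Subtype.ext x.2.1, Subtype.ext x.2.2⟩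
  have hHclass : 𝒞 H := h𝒞.hereditary C hC.mem_class H hH ⟨v, hv⟩
  let f : H →⋆ₙₐ[ℂ] SeqAlg A := ψ.comp ((NonUnitalStarSubalgebraClass.subtype C).comp
    (NonUnitalStarSubalgebraClass.subtype H))
  have hfv : f v = ψ p := rfl
  have hψn : ∀ b, ‖ψ b‖ ≤ ‖b‖ := fun b => by
    simpa using NonUnitalStarAlgHom.norm_apply_le ψ b
  have hψqe : ‖ψ p - ψ q * g‖ ≤ 25 * η := by
    rw [← hψe, ← map_mul, ← map_sub]; exact (hψn _).trans hpqe
  have hψeq : ‖ψ p - g * ψ q‖ ≤ 25 * η := by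
    rw [← hψe, ← map_mul, ← map_sub]; exact (hψn _).trans hpeq
  have hψp1 : ‖ψ p‖ ≤ 1 := (hp.map ψ).norm_le
  have hcommF : ∀ x ∈ F, ‖f v * constSeq A x - constSeq A x * f v‖ < ε := by
    intro x hx
    have h0 := hcomm (φ x) (Finset.mem_insert_of_mem (Finset.mem_image_of_mem φ hx))
    have hxM : ‖constSeq A x‖ ≤ M := (norm_constSeq_le x).trans (hM x hx)
    rw [hfv]
    -- Constants are moved through `ψ` only next to `g`, where `x g = ψ(φ(x))`; this is why both
    -- estimates `p ≈ q φ(1)` and `p ≈ φ(1) q` are needed.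
    have h1 : ψ p * constSeq A x - constSeq A x * ψ p
        = (ψ p - ψ q * g) * constSeq A x - constSeq A x * (ψ p - g * ψ q)
          + ψ (q * φ x - φ x * q) := by
      have h2 : ψ q * g * constSeq A x = ψ q * ψ (φ x) := by
        rw [mul_assoc, ← hψ.central, hψ.split]
      have h3 : constSeq A x * (g * ψ q) = ψ (φ x) * ψ q := by rw [← mul_assoc, hψ.split]
      rw [sub_mul, mul_sub, h2, h3, map_sub, map_mul, map_mul]
      abel
    rw [h1]
    have h4 : ‖(ψ p - ψ q * g) * constSeq A x‖ ≤ 25 * η * M :=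
      (norm_mul_le _ _).trans (by gcongr)
    have h5 : ‖constSeq A x * (ψ p - g * ψ q)‖ ≤ M * (25 * η) :=
      (norm_mul_le _ _).trans (by gcongr)
    have h6 := (hψn (q * φ x - φ x * q)).trans h0
    have h7 := norm_add_le ((ψ p - ψ q * g) * constSeq A x - constSeq A x * (ψ p - g * ψ q))
      (ψ (q * φ x - φ x * q))
    have h8 := norm_sub_le ((ψ p - ψ q * g) * constSeq A x) (constSeq A x * (ψ p - g * ψ q))
    nlinarith
  have happroxF : ∀ x ∈ F, ∃ d, ‖f v * constSeq A x * f v - f d‖ < ε := by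
    intro x hx
    have h0 := hdist (φ x) (Finset.mem_insert_of_mem (Finset.mem_image_of_mem φ hx))
    obtain ⟨c, hc, hcd⟩ := exists_norm_sub_lt_of_infDist_le C h0 (by linarith : η < 2 * η)
    have hxM : ‖constSeq A x‖ ≤ M := (norm_constSeq_le x).trans (hM x hx)
    let d : H := ⟨⟨p, hpC⟩ * ⟨c, hc⟩ * ⟨p, hpC⟩, mem_cornerSub.2 ⟨by
      rw [← mul_assoc, ← mul_assoc, hp'.isIdempotentElem], by
      rw [mul_assoc, hp'.isIdempotentElem]⟩⟩
    have hfd : f d = ψ (p * c * p) := rfl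
    refine ⟨d, ?_⟩
    rw [hfv, hfd]
    have hpp : ψ p * ψ p = ψ p := (hp.map ψ).isIdempotentElem
    have hpq : p * q = p := hC.mul_unit p hpC
    have h1 : ψ p * constSeq A x * ψ p - ψ (p * c * p)
        = ψ p * (constSeq A x * (ψ p - g * ψ q)) * ψ p + ψ (p * (q * φ x * q - c) * p) := by
      have h2 : constSeq A x * (g * ψ q) = ψ (φ x) * ψ q := by rw [← mul_assoc, hψ.split]
      have h3 : p * (q * φ x * q - c) * p = p * (φ x * q) * p - p * c * p := by
        rw [mul_sub, sub_mul, mul_assoc q, ← mul_assoc p q, hpq]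
      have h4 : ψ p * (constSeq A x * ψ p) * ψ p = ψ p * constSeq A x * ψ p := by
        rw [mul_assoc, mul_assoc (constSeq A x), hpp, mul_assoc]
      have h5 : ψ (p * (φ x * q) * p) = ψ p * (ψ (φ x) * ψ q) * ψ p := by simp only [map_mul]
      rw [h3, map_sub, h5, mul_sub, mul_sub, h2, sub_mul, h4, sub_add_sub_cancel]
    rw [h1]
    have hp1 : ‖p‖ ≤ 1 := hp.norm_le
    have h4 : ‖ψ p * (constSeq A x * (ψ p - g * ψ q)) * ψ p‖ ≤ 1 * (M * (25 * η)) * 1 :=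
      norm_mul₃_le.trans (by gcongr; exact (norm_mul_le _ _).trans (by gcongr))
    have h5 : ‖ψ (p * (q * φ x * q - c) * p)‖ ≤ 1 * (2 * η) * 1 :=
      (hψn _).trans (norm_mul₃_le.trans (by gcongr))
    have h6 := norm_add_le (ψ p * (constSeq A x * (ψ p - g * ψ q)) * ψ p)
      (ψ (p * (q * φ x * q - c) * p))
    nlinarith
  obtain ⟨P, hP, hPproj, hev⟩ := h𝒞.exists_eventually_isSubIn hHclass hv f F hcommF happroxF
  have htrace : ∀ᶠ n in atTop, ∀ τ : A →ₗ[ℂ] ℂ, IsTracialState 1 τ →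
      (τ ((lpConst (1 : A) - P : lp (fun _ : ℕ => A) ∞) n)).re ≤ ε := by
    refine eventually_forall_tracialState_le _ fun τ hτ hτn => ?_
    rw [map_sub, ← constSeq_eq_mk, hP, hfv]
    have h1 : constSeq A 1 - ψ p
        = (constSeq A 1 - g) + ψ (φ 1 * (1 - q)) - (ψ p - g * ψ q) := by
      rw [mul_sub, map_sub, mul_one, map_mul, hψe]; abel
    -- Traciality replaces `φ(1)(1 - q)` by `(1 - q) φ(1) (1 - q) ≤ 1 - q`.
    have h2 : (τ (ψ (φ 1 * (1 - q)))).re ≤ (τ (ψ (1 - q))).re := by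
      have hq' := hq.one_sub
      have h3 : τ (ψ (φ 1 * (1 - q))) = τ (ψ ((1 - q) * φ 1 * (1 - q))) := by
        calc τ (ψ (φ 1 * (1 - q))) = τ (ψ (φ 1 * (1 - q)) * ψ (1 - q)) := by
              rw [← map_mul, mul_assoc, hq'.isIdempotentElem]
          _ = τ (ψ (1 - q) * ψ (φ 1 * (1 - q))) := hτ.tracial _ _
          _ = _ := by rw [← map_mul, mul_assoc]
      have h4 := hτ.nonneg (ψ ((1 - φ 1) * (1 - q)))
      have h5 : star (ψ ((1 - φ 1) * (1 - q))) * ψ ((1 - φ 1) * (1 - q))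
          = ψ (1 - q) - ψ ((1 - q) * φ 1 * (1 - q)) := by
        rw [← map_star, ← map_mul, ← map_sub, star_mul, hq'.isSelfAdjoint.star_eq,
          he.one_sub.isSelfAdjoint.star_eq, mul_assoc, ← mul_assoc (1 - φ 1),
          he.one_sub.isIdempotentElem, ← mul_assoc, mul_sub (1 - q) 1, sub_mul, mul_one,
          hq'.isIdempotentElem]
      rw [h5, map_sub] at h4
      have h6 := (Complex.nonneg_iff.1 h4).1
      rw [Complex.sub_re] at h6
      rw [h3]
      linarith
    have h7 : (τ (ψ (1 - q))).re ≤ η := hτ.re_map_le hu ψ hq.one_sub hη.le htr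
    have h8 : |(τ (ψ p - g * ψ q)).re| ≤ 4 * (25 * η) :=
      (Complex.abs_re_le_norm _).trans ((hτn _).trans (by gcongr))
    have h9 := hg τ hτ
    rw [h1, map_sub, map_add, Complex.sub_re, Complex.add_re]
    have h10 := (abs_le.1 h8).1
    nlinarith
  obtain ⟨n, ⟨E, hE, hc, hd⟩, ht⟩ := (hev.and htrace).exists
  exact ⟨P n, E, hPproj n, hE, hc, hd, ht⟩

theorem IsTA.of_traciallySeqSplit {𝒞 : CStarClass.{u}} (h𝒞 : IsApproxClass 𝒞) {A B : Type u}
    [CStarAlgebra A] [CStarAlgebra B] {φ : A →⋆ₙₐ[ℂ] B} (hφ : IsTraciallySeqSplit φ)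
    (hB : IsTA 𝒞 B) : IsTA 𝒞 A := by
  classical
  intro F ε hε a ha ha0
  have : Nontrivial A := ⟨a, 0, ha0⟩
  have has : IsSelfAdjoint a := by
    obtain ⟨s, rfl⟩ := ha
    exact .star_mul_self s
  obtain ⟨ψ, hψ⟩ := hφ.exists_leftInverse
  have hφa : IsPos (φ a) := by
    obtain ⟨s, rfl⟩ := ha
    exact ⟨φ s, by rw [map_mul, map_star]⟩
  -- The left inverse makes `φ` injective, so `φ a` is a legitimate comparison element in `B`.
  have hφa0 : φ a ≠ 0 := fun h => ha0 (constSeq_eq_zero (by rw [← hψ, h, map_zero]))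
  obtain ⟨q, C, hq, hC, hcomm, hdist, hbelow⟩ := hB (F.image φ) (ε / 4) (by positivity) _ hφa hφa0
  have hu : IsUnitOf (constSeq A 1) := isUnitOf_constSeq_one
  -- `ψ` is unital even if `φ` is not, since already `ψ(φ(1)) = 1`; so `ψ(1 - q)` is the full
  -- defect.
  have hψ1 : ψ 1 = constSeq A 1 := by
    calc ψ 1 = ψ (φ 1) * ψ 1 := by rw [hψ, (hu _).1]
      _ = constSeq A 1 := by rw [← map_mul, mul_one, hψ]
  have hψn : ∀ b, ‖ψ b‖ ≤ ‖b‖ := fun b => by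
    simpa using NonUnitalStarAlgHom.norm_apply_le ψ b
  have hCc := hC.isClosed
  let v : C := ⟨q, hC.unit_mem⟩
  have hv : IsUnitOf v :=
    fun x => ⟨Subtype.ext (hC.unit_mul _ x.2), Subtype.ext (hC.mul_unit _ x.2)⟩
  let f : C →⋆ₙₐ[ℂ] SeqAlg A := ψ.comp (NonUnitalStarSubalgebraClass.subtype C)
  have hfv : f v = ψ q := rfl
  obtain ⟨P, hP, hPproj, hev⟩ := h𝒞.exists_eventually_isSubIn hC.mem_class hv f F (ε := ε)
    (fun x hx => by
      rw [hfv, ← hψ, ← map_mul, ← map_mul, ← map_sub]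
      have := (hψn _).trans (hcomm _ (Finset.mem_image_of_mem φ hx))
      linarith)
    (fun x hx => by
      obtain ⟨c, hc, hcd⟩ := exists_norm_sub_lt_of_infDist_le C
        (hdist _ (Finset.mem_image_of_mem φ hx)) (by linarith : ε / 4 < ε)
      refine ⟨⟨c, hc⟩, ?_⟩
      have hfc : f ⟨c, hc⟩ = ψ c := rfl
      rw [hfv, hfc, ← hψ, ← map_mul, ← map_mul, ← map_sub]
      exact (hψn _).trans_lt hcd)
  have hQ : ∀ᶠ n in atTop, MvNBelow ((lpConst (1 : A) - P : lp (fun _ : ℕ => A) ∞) n) a := by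
    refine eventually_mvNBelow has (fun n => (hPproj n).one_sub) ?_
    rw [map_sub, ← constSeq_eq_mk, hP, hfv, ← hψ1, ← map_sub, ← hψ a]
    exact hbelow.map ψ
  obtain ⟨n, ⟨E, hE, hc, hd⟩, hn⟩ := (hev.and hQ).exists
  exact ⟨P n, E, hPproj n, hE, hc, hd, hn⟩

theorem mainTheorem4 (𝒞 : CStarClass.{u}) (h𝒞 : IsApproxClass 𝒞)
    (A B : Type u) [CStarAlgebra A] [CStarAlgebra B] (φ : A →⋆ₙₐ[ℂ] B) :
    (IsTraciallySeqSplit φ ∨ IsTraciallySeqSplitTrace φ → IsTATrace 𝒞 B → IsTATrace 𝒞 A) ∧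
      (IsTraciallySeqSplit φ → IsTA 𝒞 B → IsTA 𝒞 A) :=
  ⟨fun h hB => .of_traceSplit h𝒞 (h.elim (·.traceForm) id) hB,
    fun h hB => .of_traciallySeqSplit h𝒞 h hB⟩
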